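/- Let $\mathcal{A}$ and $\mathcal{B}$ be Frobenius categories, i.e. Quillen exact categories with enough projectives and enough injectives in which the projective objects coincide with the injective objects. The stable category $\underline{\mathcal{A}}$ is the factor category of $\mathcal{A}$ by the ideal of morphisms that factor through a projective object. A pretriangle-equivalence between Frobenius categories is an additive functor that sends conflations to conflations and projectives to projectives, and whose induced functor between the stable categories is an equivalence. For $n\geq 1$, let ${\rm Inf}_n(\mathcal{A})$ be the category whose objects are the sequences $X^1\rightarrow X^2\rightarrow\cdots\rightarrow X^n$ of $n-1$ composable inflations in $\mathcal{A}$ and whose morphisms are the families $(f^s\colon X^s\rightarrow Y^s)_{1\leq s\leq n}$ commuting with the structure maps; its conflations are the sequences whose components at all $s$ are conflations in $\mathcal{A}$. Let $F\colon \mathcal{A}\rightarrow\mathcal{B}$ be a pretriangle-equivalence. Then for each $n\geq 1$, ${\rm Inf}_n(\mathcal{A})$ and ${\rm Inf}_n(\mathcal{B})$ are Frobenius categories, and the functor ${\rm Inf}_n(F)\colon {\rm Inf}_n(\mathcal{A})\rightarrow{\rm Inf}_n(\mathcal{B})$ that applies $F$ to all objects and structure maps of an $n$-inflation is also a pretriangle-equivalence.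 -/

import Mathlib

open CategoryTheory CategoryTheory.Limits

universe v v' u u'

namespace FrobeniusInflation

section Exact

variable {C : Type u} [Category.{v} C] [Preadditive C]

/-- `i` is an inflation for the class `E` of conflations: it is the first map of a conflation. -/
def Inflation (E : ObjectProperty (ShortComplex C)) {X Y : C} (i : X ⟶ Y) : Prop :=
  ∃ (Z : C) (p : Y ⟶ Z) (w : i ≫ p = 0), E (ShortComplex.mk i p w)

/-- `p` is a deflation for the class `E` of conflations: it is the second map of a conflation. -/
def Deflation (E : ObjectProperty (ShortComplex C)) {Y Z : C} (p : Y ⟶ Z) : Prop :=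
  ∃ (X : C) (i : X ⟶ Y) (w : i ≫ p = 0), E (ShortComplex.mk i p w)

/-- The pair `(C, E)` is an exact category in the sense of Quillen: `C` is additive, and `E` is an
isomorphism-closed class of kernel-cokernel pairs such that identities are inflations and
deflations, inflations and deflations are closed under composition, and pushouts of inflations
(pullbacks of deflations) along arbitrary morphisms exist and are inflations (deflations). -/
structure IsExactCategory (E : ObjectProperty (ShortComplex C)) : Prop where
  hasZeroObject : HasZeroObject C
  hasBinaryBiproducts : HasBinaryBiproducts C
  of_iso : ∀ {S T : ShortComplex C}, (S ≅ T) → E S → E T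
  isKernel : ∀ S : ShortComplex C, E S → Nonempty (IsLimit (KernelFork.ofι S.f S.zero))
  isCokernel : ∀ S : ShortComplex C, E S → Nonempty (IsColimit (CokernelCofork.ofπ S.g S.zero))
  inflation_id : ∀ X : C, Inflation E (𝟙 X)
  deflation_id : ∀ X : C, Deflation E (𝟙 X)
  inflation_comp : ∀ {X Y Z : C} (i : X ⟶ Y) (j : Y ⟶ Z),
    Inflation E i → Inflation E j → Inflation E (i ≫ j)
  deflation_comp : ∀ {X Y Z : C} (p : X ⟶ Y) (q : Y ⟶ Z),
    Deflation E p → Deflation E q → Deflation E (p ≫ q)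
  inflation_pushout : ∀ {X Y X' : C} (i : X ⟶ Y) (f : X ⟶ X'), Inflation E i →
    ∃ (Y' : C) (f' : Y ⟶ Y') (i' : X' ⟶ Y'), IsPushout i f f' i' ∧ Inflation E i'
  deflation_pullback : ∀ {Y Z Z' : C} (p : Y ⟶ Z) (f : Z' ⟶ Z), Deflation E p →
    ∃ (Y' : C) (f' : Y' ⟶ Y) (p' : Y' ⟶ Z'), IsPullback f' p' p f ∧ Deflation E p'

/-- Projective objects relative to `E`: morphisms out of `P` lift along every deflation. -/
def IsProj (E : ObjectProperty (ShortComplex C)) (P : C) : Prop :=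
  ∀ ⦃Y Z : C⦄ (p : Y ⟶ Z), Deflation E p → ∀ f : P ⟶ Z, ∃ g : P ⟶ Y, g ≫ p = f

/-- Injective objects relative to `E`: morphisms into `I` extend along every inflation. -/
def IsInj (E : ObjectProperty (ShortComplex C)) (I : C) : Prop :=
  ∀ ⦃X Y : C⦄ (i : X ⟶ Y), Inflation E i → ∀ f : X ⟶ I, ∃ g : Y ⟶ I, i ≫ g = f

/-- `(C, E)` is a Frobenius category: an exact category with enough projectives and enough
injectives, in which projectives and injectives coincide. -/
structure IsFrobeniusCategory (E : ObjectProperty (ShortComplex C)) : Prop where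
  exact : IsExactCategory E
  enough_projectives : ∀ X : C, ∃ (P : C) (p : P ⟶ X), IsProj E P ∧ Deflation E p
  enough_injectives : ∀ X : C, ∃ (I : C) (i : X ⟶ I), IsInj E I ∧ Inflation E i
  proj_iff_inj : ∀ X : C, IsProj E X ↔ IsInj E X

/-- Two parallel morphisms are stably equal if their difference factors through a projective. -/
def stableRel (E : ObjectProperty (ShortComplex C)) : HomRel C := fun X Y f g =>
  ∃ (P : C) (a : X ⟶ P) (b : P ⟶ Y), IsProj E P ∧ f - g = a ≫ b

/-- In an exact category, stable equality is a congruence, so that the morphisms of the quotient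
category below are the classes of morphisms modulo those that factor through a projective. -/
theorem IsExactCategory.congruence_stableRel {E : ObjectProperty (ShortComplex C)}
    (hE : IsExactCategory E) : Congruence (stableRel E) where
  equivalence := by
    intro X Y
    have := hE.hasZeroObject
    have := hE.hasBinaryBiproducts
    refine ⟨fun f => ?_, ?_, ?_⟩
    · obtain ⟨Z, hZ⟩ := hE.hasZeroObject
      exact ⟨Z, 0, 0, fun _ _ _ _ f => ⟨0, hZ.eq_of_src _ _⟩, by simp⟩
    · rintro f g ⟨P, a, b, hP, h⟩
      exact ⟨P, a, -b, hP, by rw [Preadditive.comp_neg, ← h, neg_sub]⟩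
    · rintro f g k ⟨P, a, b, hP, h⟩ ⟨Q, c, d, hQ, h'⟩
      refine ⟨P ⊞ Q, biprod.lift a c, biprod.desc b d, ?_, ?_⟩
      · intro Y Z p hp f
        obtain ⟨g₁, h₁⟩ := hP p hp (biprod.inl ≫ f)
        obtain ⟨g₂, h₂⟩ := hQ p hp (biprod.inr ≫ f)
        exact ⟨biprod.desc g₁ g₂, by ext <;> simp [h₁, h₂]⟩
      · rw [biprod.lift_desc, ← h, ← h', sub_add_sub_cancel]
  comp_left := by
    rintro X Y Z f g g' ⟨P, a, b, hP, h⟩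
    exact ⟨P, f ≫ a, b, hP, by rw [← Preadditive.comp_sub, h, Category.assoc]⟩
  comp_right := by
    rintro X Y Z f f' g ⟨P, a, b, hP, h⟩
    exact ⟨P, a, b ≫ g, hP, by rw [← Preadditive.sub_comp, h, Category.assoc]⟩

/-- The stable category: the factor category of `C` by the ideal of morphisms that factor through
a projective object. -/
abbrev StableCategory (E : ObjectProperty (ShortComplex C)) : Type u :=
  CategoryTheory.Quotient (stableRel E)

end Exact

section Functors

variable {A : Type u} [Category.{v} A] [Preadditive A]
  {B : Type u'} [Category.{v'} B] [Preadditive B]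

/-- An additive functor is exact if it sends conflations to conflations. -/
def IsExactFunctor (E : ObjectProperty (ShortComplex A)) (E' : ObjectProperty (ShortComplex B))
    (F : A ⥤ B) [F.Additive] : Prop :=
  ∀ S : ShortComplex A, E S → E' (S.map F)

theorem IsExactFunctor.map_inflation {E : ObjectProperty (ShortComplex A)}
    {E' : ObjectProperty (ShortComplex B)} {F : A ⥤ B} [F.Additive] (hF : IsExactFunctor E E' F)
    {X Y : A} {i : X ⟶ Y} (hi : Inflation E i) : Inflation E' (F.map i) := by
  obtain ⟨Z, p, w, h⟩ := hi
  exact ⟨F.obj Z, F.map p, by rw [← F.map_comp, w, F.map_zero], hF _ h⟩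

/-- The functor between stable categories induced by an additive functor that sends projectives
to projectives. -/
def stableFunctor (E : ObjectProperty (ShortComplex A)) (E' : ObjectProperty (ShortComplex B))
    (F : A ⥤ B) [F.Additive] (hF : ∀ P : A, IsProj E P → IsProj E' (F.obj P)) :
    StableCategory E ⥤ StableCategory E' :=
  CategoryTheory.Quotient.lift (stableRel E) (F ⋙ CategoryTheory.Quotient.functor (stableRel E'))
    (by
      rintro X Y f g ⟨P, a, b, hP, h⟩
      refine CategoryTheory.Quotient.sound _ ⟨F.obj P, F.map a, F.map b, hF P hP, ?_⟩
      rw [← F.map_sub, h, F.map_comp])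

/-- A pretriangle-equivalence (between Frobenius categories): an exact functor that sends
projectives to projectives and whose induced functor on stable categories is an equivalence. -/
structure IsPretriangleEquivalence (E : ObjectProperty (ShortComplex A))
    (E' : ObjectProperty (ShortComplex B)) (F : A ⥤ B) [F.Additive] : Prop where
  exact : IsExactFunctor E E' F
  map_proj : ∀ P : A, IsProj E P → IsProj E' (F.obj P)
  isEquivalence : (stableFunctor E E' F map_proj).IsEquivalence

end Functors

section Inflations

variable {A : Type u} [Category.{v} A] [Preadditive A]
  {B : Type u'} [Category.{v'} B] [Preadditive B]

/-- A sequence `X 0 ⟶ X 1 ⟶ ⋯ ⟶ X (n - 1)` of `n` objects, as a functor on the linearly ordered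
set `Fin n`, is an `n`-inflation if its `n - 1` consecutive maps are inflations. -/
def isInflationSeq (E : ObjectProperty (ShortComplex A)) (n : ℕ) : ObjectProperty (Fin n ⥤ A) :=
  fun X => ∀ (s : ℕ) (hs : s + 1 < n),
    Inflation E (X.map (homOfLE (Fin.mk_le_mk.2 (Nat.le_succ s)) :
      (⟨s, Nat.lt_of_succ_lt hs⟩ : Fin n) ⟶ ⟨s + 1, hs⟩))

/-- The category of `n`-inflations; morphisms are the families of morphisms between the components
that commute with the structure maps. -/
abbrev Inf (E : ObjectProperty (ShortComplex A)) (n : ℕ) : Type (max u v) :=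
  (isInflationSeq E n).FullSubcategory

/-- The functor sending an `n`-inflation to its component at `s`. -/
abbrev Inf.component (E : ObjectProperty (ShortComplex A)) (n : ℕ) (s : Fin n) : Inf E n ⥤ A :=
  (isInflationSeq E n).ι ⋙ (evaluation (Fin n) A).obj s

instance (E : ObjectProperty (ShortComplex A)) (n : ℕ) (s : Fin n) :
    (Inf.component E n s).Additive where
  map_add := rfl

/-- The conflations of `Inf E n`: sequences that are conflations in each component. -/
def infConflations (E : ObjectProperty (ShortComplex A)) (n : ℕ) :
    ObjectProperty (ShortComplex (Inf E n)) :=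
  fun S => ∀ s : Fin n, E (S.map (Inf.component E n s))

/-- The functor `Inf_n(F)` induced by an exact functor `F`, which applies `F` to all components
and structure maps. -/
def infFunctor {E : ObjectProperty (ShortComplex A)} {E' : ObjectProperty (ShortComplex B)}
    (n : ℕ) (F : A ⥤ B) [F.Additive] (hF : IsExactFunctor E E' F) : Inf E n ⥤ Inf E' n :=
  (isInflationSeq E' n).lift
    ((isInflationSeq E n).ι ⋙ (Functor.whiskeringRight (Fin n) A B).obj F)
    (fun X s hs => hF.map_inflation (X.property s hs))

instance {E : ObjectProperty (ShortComplex A)} {E' : ObjectProperty (ShortComplex B)}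
    (n : ℕ) (F : A ⥤ B) [F.Additive] (hF : IsExactFunctor E E' F) :
    (infFunctor n F hF).Additive where
  map_add := by
    intro X Y f g
    apply ObjectProperty.hom_ext
    ext s
    exact F.map_add

end Inflations

end FrobeniusInflation

/-! Sequences are handled one index at a time. The key fact is `inflation_corner`: in a morphism of
conflations whose cokernel component is an inflation, the corner map out of the pushout of the left
square is an inflation. Hence inflation sequences are closed under pointwise extensions
(`isInflationSeq_of_conf`), so pointwise pushouts and pullbacks of conflations stay in `Inf E n` and
make it exact. Corner maps also let morphisms into pointwise injective sequences be extended from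
one index to the next. Together with enough pointwise projective and pointwise injective sequences,
this shows that both projectivity and injectivity in `Inf E n` are pointwise conditions, so they
coincide.

Stable density of the induced functor holds because any morphism becomes an inflation after an
injective summand is added to its target (`exists_obj_step`). For stable fullness, choose an
inflation `i : X ⟶ I` with `I` pointwise injective. The induction carries strict equations `g = F f
+ F i ≫ e` at each index, since compatibility up to stable equality would not yield a morphism of
sequences (`exists_map_step`).

Stable faithfulness cannot be tested pointwise: a morphism with stably zero components need not be
stably zero. Stable isomorphisms can be so tested (`stIso_inf`): with `p : P ⟶ Y` a deflation from a
projective, `f` is a stable isomorphism exactly when the kernel of `(f, p) : X ⊞ P ⟶ Y` is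
projective, a pointwise condition. Faithfulness then follows from fullness and reflection of stable
automorphisms (`stableRel_zero_of_map`). -/

namespace FrobeniusInflation

/-! ### Diagram lemmas in a Quillen exact category. -/

section ExactCategory

variable {C : Type u} [Category.{v} C] [Preadditive C] {E : ObjectProperty (ShortComplex C)}

/-- The composable pair `(i, p)` is a conflation. -/
def Conf (E : ObjectProperty (ShortComplex C)) {X Y Z : C} (i : X ⟶ Y) (p : Y ⟶ Z) : Prop :=
  ∃ w : i ≫ p = 0, E (ShortComplex.mk i p w)

namespace Conf

variable {X Y Z : C} {i : X ⟶ Y} {p : Y ⟶ Z}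

lemma inflation (h : Conf E i p) : Inflation E i := ⟨Z, p, h⟩

lemma deflation (h : Conf E i p) : Deflation E p := ⟨X, i, h⟩

lemma w (h : Conf E i p) : i ≫ p = 0 := h.1

lemma mono (hE : IsExactCategory E) (h : Conf E i p) : Mono i := by
  obtain ⟨hl⟩ := hE.isKernel _ h.2
  exact mono_of_isLimit_fork hl

lemma epi (hE : IsExactCategory E) (h : Conf E i p) : Epi p := by
  obtain ⟨hl⟩ := hE.isCokernel _ h.2
  exact epi_of_isColimit_cofork hl

lemma exists_lift (hE : IsExactCategory E) (h : Conf E i p) {T : C} (t : T ⟶ Y)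
    (ht : t ≫ p = 0) : ∃ u : T ⟶ X, u ≫ i = t := by
  obtain ⟨hl⟩ := hE.isKernel _ h.2
  exact ⟨_, (KernelFork.IsLimit.lift' hl t ht).2⟩

lemma exists_desc (hE : IsExactCategory E) (h : Conf E i p) {T : C} (t : Y ⟶ T)
    (ht : i ≫ t = 0) : ∃ u : Z ⟶ T, p ≫ u = t := by
  obtain ⟨hl⟩ := hE.isCokernel _ h.2
  exact ⟨_, (CokernelCofork.IsColimit.desc' hl t ht).2⟩

lemma of_iso (hE : IsExactCategory E) (h : Conf E i p) {X' Y' Z' : C} {i' : X' ⟶ Y'}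
    {p' : Y' ⟶ Z'} (a : X ≅ X') (b : Y ≅ Y') (c : Z ≅ Z') (h₁ : a.hom ≫ i' = i ≫ b.hom)
    (h₂ : b.hom ≫ p' = p ≫ c.hom) : Conf E i' p' := by
  have w' : i' ≫ p' = 0 := by
    rw [← cancel_epi a.hom, reassoc_of% h₁, h₂, reassoc_of% h.w]; simp
  exact ⟨w', hE.of_iso (ShortComplex.isoMk a b c h₁ h₂) h.2⟩

end Conf

lemma Inflation.exists_conf {X Y : C} {i : X ⟶ Y} (h : Inflation E i) :
    ∃ (Z : C) (p : Y ⟶ Z), Conf E i p := h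

lemma Deflation.exists_conf {Y Z : C} {p : Y ⟶ Z} (h : Deflation E p) :
    ∃ (X : C) (i : X ⟶ Y), Conf E i p := h

namespace IsExactCategory

variable (hE : IsExactCategory E)
include hE

lemma conf_of_kernel {X Y Z : C} {i : X ⟶ Y} {p : Y ⟶ Z} (hp : Deflation E p) (w : i ≫ p = 0)
    (hi : Mono i) (hl : ∀ ⦃T : C⦄ (t : T ⟶ Y), t ≫ p = 0 → ∃ u : T ⟶ X, u ≫ i = t) :
    Conf E i p := by
  obtain ⟨X', i', h⟩ := hp.exists_conf
  have := h.mono hE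
  obtain ⟨a, ha⟩ := hl i' h.w
  obtain ⟨b, hb⟩ := h.exists_lift hE i w
  exact h.of_iso hE ⟨a, b, by rw [← cancel_mono i']; simp [ha, hb],
    by rw [← cancel_mono i]; simp [ha, hb]⟩ (Iso.refl _) (Iso.refl _) (by simp [ha]) (by simp)

lemma conf_of_cokernel {X Y Z : C} {i : X ⟶ Y} {p : Y ⟶ Z} (hi : Inflation E i)
    (w : i ≫ p = 0) (hp : Epi p)
    (hl : ∀ ⦃T : C⦄ (t : Y ⟶ T), i ≫ t = 0 → ∃ u : Z ⟶ T, p ≫ u = t) :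
    Conf E i p := by
  obtain ⟨Z', p', h⟩ := hi.exists_conf
  have := h.epi hE
  obtain ⟨a, ha⟩ := hl p' h.w
  obtain ⟨b, hb⟩ := h.exists_desc hE p w
  exact h.of_iso hE (Iso.refl _) (Iso.refl _)
    ⟨b, a, by rw [← cancel_epi p']; simp [ha, reassoc_of% hb],
    by rw [← cancel_epi p]; simp [hb, reassoc_of% ha]⟩ (by simp) (by simp [hb])

lemma inflation_of_isIso {X Y : C} (f : X ⟶ Y) [IsIso f] : Inflation E f := by
  obtain ⟨Z, p, h⟩ := (hE.inflation_id X).exists_conf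
  exact (h.of_iso hE (i' := f) (p' := inv f ≫ p) (Iso.refl _) (asIso f) (Iso.refl _)
    (by simp) (by simp)).inflation

lemma deflation_of_isIso {X Y : C} (f : X ⟶ Y) [IsIso f] : Deflation E f := by
  obtain ⟨Z, p, h⟩ := (hE.deflation_id X).exists_conf
  exact (h.of_iso hE (i' := p) (p' := f) (Iso.refl _) (Iso.refl _) (asIso f)
    (by simp) (by simp)).deflation

lemma conf_id_zero (X : C) {Z : C} (hZ : IsZero Z) : Conf E (𝟙 X) (0 : X ⟶ Z) :=
  hE.conf_of_cokernel (hE.inflation_id X) (by simp) ⟨fun _ _ _ => hZ.eq_of_src _ _⟩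
    fun _ t ht => ⟨0, by simp at ht; simp [ht]⟩

lemma conf_zero_id (X : C) {Z : C} (hZ : IsZero Z) : Conf E (0 : Z ⟶ X) (𝟙 X) :=
  hE.conf_of_kernel (hE.deflation_id X) (by simp) ⟨fun _ _ _ => hZ.eq_of_tgt _ _⟩
    fun _ t ht => ⟨0, by simp at ht; simp [ht]⟩

lemma deflation_of_isPullback {Y Z Y' Z' : C} {p : Y ⟶ Z} {f : Z' ⟶ Z} {f' : Y' ⟶ Y}
    {p' : Y' ⟶ Z'} (hp : Deflation E p) (sq : IsPullback f' p' p f) : Deflation E p' := by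
  obtain ⟨P, g, q, sq', hq⟩ := hE.deflation_pullback p f hp
  obtain ⟨X, i, h⟩ := hq.exists_conf
  exact (h.of_iso hE (i' := i ≫ (sq'.isoIsPullback _ _ sq).hom) (p' := p') (Iso.refl _)
    (sq'.isoIsPullback _ _ sq) (Iso.refl _) (by simp) (by simp)).deflation

lemma inflation_of_isPushout {X Y X' Y' : C} {i : X ⟶ Y} {f : X ⟶ X'} {f' : Y ⟶ Y'}
    {i' : X' ⟶ Y'} (hi : Inflation E i) (sq : IsPushout i f f' i') : Inflation E i' := by
  obtain ⟨P, g, q, sq', hq⟩ := hE.inflation_pushout i f hi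
  obtain ⟨X, p, h⟩ := hq.exists_conf
  exact (h.of_iso hE (i' := i') (p' := (sq'.isoIsPushout _ _ sq).inv ≫ p) (Iso.refl _)
    (sq'.isoIsPushout _ _ sq) (Iso.refl _) (by simp) (by simp)).inflation

/-- The pullback of a conflation is a conflation with the same kernel. -/
lemma conf_of_isPullback {X Y Z Y' Z' : C} {i : X ⟶ Y} {p : Y ⟶ Z} (h : Conf E i p)
    {f : Z' ⟶ Z} {f' : Y' ⟶ Y} {p' : Y' ⟶ Z'} (sq : IsPullback f' p' p f) {i' : X ⟶ Y'}
    (h₁ : i' ≫ f' = i) (h₂ : i' ≫ p' = 0) : Conf E i' p' := by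
  have := h.mono hE
  refine hE.conf_of_kernel (hE.deflation_of_isPullback h.deflation sq) h₂
    (mono_of_mono_fac h₁) fun T t ht => ?_
  obtain ⟨u, hu⟩ := h.exists_lift hE (t ≫ f')
    (by rw [Category.assoc, sq.w, reassoc_of% ht, zero_comp])
  exact ⟨u, sq.hom_ext (by simp [h₁, hu]) (by simp [h₂, ht])⟩

/-- The pushout of a conflation is a conflation with the same cokernel. -/
lemma conf_of_isPushout {X Y Z X' Y' : C} {i : X ⟶ Y} {p : Y ⟶ Z} (h : Conf E i p)
    {f : X ⟶ X'} {f' : Y ⟶ Y'} {i' : X' ⟶ Y'} (sq : IsPushout i f f' i') {p' : Y' ⟶ Z}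
    (h₁ : f' ≫ p' = p) (h₂ : i' ≫ p' = 0) : Conf E i' p' := by
  have := h.epi hE
  refine hE.conf_of_cokernel (hE.inflation_of_isPushout h.inflation sq) h₂
    (epi_of_epi_fac h₁) fun T t ht => ?_
  obtain ⟨u, hu⟩ := h.exists_desc hE (f' ≫ t) (by rw [reassoc_of% sq.w, ht, comp_zero])
  exact ⟨u, sq.hom_ext (by rw [reassoc_of% h₁, hu]) (by rw [reassoc_of% h₂, ht, zero_comp])⟩

lemma exists_pullback {X Y Z Z' : C} {i : X ⟶ Y} {p : Y ⟶ Z} (h : Conf E i p) (f : Z' ⟶ Z) :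
    ∃ (Y' : C) (f' : Y' ⟶ Y) (p' : Y' ⟶ Z') (i' : X ⟶ Y'),
      IsPullback f' p' p f ∧ Conf E i' p' ∧ i' ≫ f' = i := by
  obtain ⟨Y', f', p', sq, -⟩ := hE.deflation_pullback p f h.deflation
  exact ⟨Y', f', p', sq.lift i 0 (by simp [h.w]), sq,
    hE.conf_of_isPullback h sq (by simp) (by simp), by simp⟩

lemma exists_pushout {X Y Z X' : C} {i : X ⟶ Y} {p : Y ⟶ Z} (h : Conf E i p) (f : X ⟶ X') :
    ∃ (Y' : C) (f' : Y ⟶ Y') (i' : X' ⟶ Y') (p' : Y' ⟶ Z),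
      IsPushout i f f' i' ∧ Conf E i' p' ∧ f' ≫ p' = p := by
  obtain ⟨Y', f', i', sq, -⟩ := hE.inflation_pushout i f h.inflation
  exact ⟨Y', f', i', sq.desc p 0 (by simp [h.w]), sq,
    hE.conf_of_isPushout h sq (by simp) (by simp), by simp⟩

/-- The short five lemma. -/
lemma isIso_of_conf {X Y Y' Z : C} {i : X ⟶ Y} {p : Y ⟶ Z} {i' : X ⟶ Y'} {p' : Y' ⟶ Z}
    (h : Conf E i p) (h' : Conf E i' p') (b : Y ⟶ Y') (h₁ : i ≫ b = i') (h₂ : b ≫ p' = p) :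
    IsIso b := by
  have := h.mono hE
  have := h'.mono hE
  have hb : Mono b := by
    refine Preadditive.mono_of_cancel_zero _ fun {T} t ht => ?_
    obtain ⟨u, rfl⟩ := h.exists_lift hE t (by rw [← h₂, reassoc_of% ht, zero_comp])
    rw [Category.assoc, h₁] at ht
    rw [zero_of_comp_mono _ ht, zero_comp]
  -- The base change `π'` of `p` along `p'` is a deflation. Correcting `π` by a map through `i`
  -- makes `π'` factor through `b`; since `b` is mono, this factorization descends along `π'` to an
  -- inverse.
  obtain ⟨Q, π, π', sq, hd⟩ := hE.deflation_pullback p p' h.deflation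
  obtain ⟨N, κ, hκ⟩ := hd.exists_conf
  have := hκ.epi hE
  obtain ⟨e, he⟩ := h'.exists_lift hE (π ≫ b - π') (by simp [h₂, sq.w])
  have hm : (π - e ≫ i) ≫ b = π' := by simp [h₁, he]
  obtain ⟨r, hr⟩ := hκ.exists_desc hE (π - e ≫ i)
    (by rw [← cancel_mono b, Category.assoc, hm, hκ.w, zero_comp])
  have hrb : r ≫ b = 𝟙 _ := by rw [← cancel_epi π', reassoc_of% hr, hm, Category.comp_id]
  exact ⟨r, by rw [← cancel_mono b, Category.assoc, hrb]; simp, hrb⟩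

/-- In a morphism of conflations whose last component is an inflation, the induced morphism from
the pushout of the first square is an inflation. -/
lemma inflation_corner {X Y Z X' Y' Z' P : C} {i : X ⟶ Y} {p : Y ⟶ Z} {i' : X' ⟶ Y'}
    {p' : Y' ⟶ Z'} (h : Conf E i p) (h' : Conf E i' p') {a : X ⟶ X'} {b : Y ⟶ Y'} {c : Z ⟶ Z'}
    (h₂ : p ≫ c = b ≫ p') (hc : Inflation E c) {f : Y ⟶ P}
    {j : X' ⟶ P} (sq : IsPushout i a f j) {d : P ⟶ Y'} (hf : f ≫ d = b) (hj : j ≫ d = i') :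
    Inflation E d := by
  obtain ⟨W, q, hq⟩ := hc.exists_conf
  -- The pullback `K` of `p'` along `c` is the kernel of `p' ≫ q`, so `K ⟶ Y'` is an inflation. Both
  -- `P` and `K` are extensions of `Z` by `X'`, hence isomorphic by the short five lemma.
  obtain ⟨K, g, π, k, sq', hk, hkg⟩ := hE.exists_pullback h' c
  have hP : Conf E j (sq.desc p 0 (by simp [h.w])) :=
    hE.conf_of_isPushout h sq (by simp) (by simp)
  have hK : Conf E g (p' ≫ q) := by
    have := hq.mono hE
    refine hE.conf_of_kernel (hE.deflation_comp _ _ h'.deflation hq.deflation)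
      (by rw [reassoc_of% sq'.w, hq.w, comp_zero]) sq'.mono_fst_of_mono fun T t ht => ?_
    obtain ⟨u, hu⟩ := hq.exists_lift hE (t ≫ p') (by simpa using ht)
    exact ⟨sq'.lift t u hu.symm, by simp⟩
  have w : d ≫ p' = sq.desc p 0 (by simp [h.w]) ≫ c :=
    sq.hom_ext (by simp [reassoc_of% hf, h₂]) (by simp [reassoc_of% hj, h'.w])
  have := hE.isIso_of_conf hP hk (sq'.lift d _ w)
    (sq'.hom_ext (by simp [hj, hkg]) (by simp [hP.w, hk.w])) (by simp)
  rw [← sq'.lift_fst d _ w]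
  exact hE.inflation_comp _ _ (hE.inflation_of_isIso _) hK.inflation

/-- In a morphism of conflations whose outer components are inflations, so is the middle one. -/
lemma inflation_of_conf {X Y Z X' Y' Z' : C} {i : X ⟶ Y} {p : Y ⟶ Z} {i' : X' ⟶ Y'}
    {p' : Y' ⟶ Z'} (h : Conf E i p) (h' : Conf E i' p') {a : X ⟶ X'} {b : Y ⟶ Y'} {c : Z ⟶ Z'}
    (h₁ : i ≫ b = a ≫ i') (h₂ : p ≫ c = b ≫ p') (ha : Inflation E a) (hc : Inflation E c) :
    Inflation E b := by
  obtain ⟨P, f, j, -, sq, -⟩ := hE.exists_pushout h a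
  rw [← sq.inl_desc b i' h₁]
  exact hE.inflation_comp _ _ (hE.inflation_of_isPushout ha sq.flip)
    (hE.inflation_corner h h' h₂ hc sq (by simp) (by simp))

/-- A morphism of conflations that is the identity on cokernels is given by a pushout. -/
lemma isPushout_of_conf {X Y Z X' Y' : C} {i : X ⟶ Y} {p : Y ⟶ Z} {i' : X' ⟶ Y'}
    {p' : Y' ⟶ Z} (h : Conf E i p) (h' : Conf E i' p') {a : X ⟶ X'} {b : Y ⟶ Y'}
    (h₁ : i ≫ b = a ≫ i') (h₂ : b ≫ p' = p) : IsPushout i a b i' := by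
  obtain ⟨P, f, j, q, sq, hq, hfq⟩ := hE.exists_pushout h a
  have := hE.isIso_of_conf hq h' (sq.desc b i' h₁) (by simp)
    (sq.hom_ext (by simp [h₂, hfq]) (by simp [h'.w, hq.w]))
  exact sq.of_iso (Iso.refl _) (Iso.refl _) (Iso.refl _) (asIso (sq.desc b i' h₁))
    (by simp) (by simp) (by simp) (by simp)

/-- The cokernel of a composite of inflations is the pushout of the second one along the cokernel
of the first one. -/
lemma conf_comp_of_isPushout {X Y Z W V : C} {i : X ⟶ Y} {p : Y ⟶ Z} (h : Conf E i p)
    {j : Y ⟶ W} (hj : Inflation E j) {n : W ⟶ V} {k : Z ⟶ V} (sq : IsPushout j p n k) :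
    Conf E (i ≫ j) n := by
  have := h.epi hE
  refine hE.conf_of_cokernel (hE.inflation_comp _ _ h.inflation hj)
    (by rw [Category.assoc, sq.w, reassoc_of% h.w, zero_comp]) sq.epi_inl_of_epi fun T t ht => ?_
  obtain ⟨u, hu⟩ := h.exists_desc hE (j ≫ t) (by simpa using ht)
  exact ⟨sq.desc t u hu.symm, by simp⟩

/-- The kernel of a composite of deflations is the pullback of the first one along the kernel of
the second one. -/
lemma conf_comp_of_isPullback {X Y Z W V : C} {i : X ⟶ Y} {p : Y ⟶ Z} (h : Conf E i p)
    {q : W ⟶ Y} (hq : Deflation E q) {n : V ⟶ W} {k : V ⟶ X} (sq : IsPullback n k q i) :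
    Conf E n (q ≫ p) := by
  have := h.mono hE
  refine hE.conf_of_kernel (hE.deflation_comp _ _ hq h.deflation)
    (by rw [reassoc_of% sq.w, h.w, comp_zero]) sq.mono_fst_of_mono fun T t ht => ?_
  obtain ⟨u, hu⟩ := h.exists_lift hE (t ≫ q) (by simpa using ht)
  exact ⟨sq.lift t u hu.symm, by simp⟩

section Biproducts

variable [HasBinaryBiproducts C]

lemma conf_inl_snd (X Y : C) : Conf E (biprod.inl : X ⟶ X ⊞ Y) biprod.snd := by
  obtain ⟨Z, hZ⟩ := hE.hasZeroObject
  have sq : IsPullback (biprod.fst : X ⊞ Y ⟶ X) biprod.snd (0 : X ⟶ Z) 0 :=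
    IsPullback.mk' (by simp) (fun T φ φ' h₁ h₂ => by ext <;> assumption)
      fun T a b _ => ⟨biprod.lift a b, by simp, by simp⟩
  exact hE.conf_of_isPullback (hE.conf_id_zero X hZ) sq (by simp) (by simp)

lemma conf_inr_fst (X Y : C) : Conf E (biprod.inr : Y ⟶ X ⊞ Y) biprod.fst := by
  obtain ⟨Z, hZ⟩ := hE.hasZeroObject
  have sq : IsPullback (biprod.snd : X ⊞ Y ⟶ Y) biprod.fst (0 : Y ⟶ Z) 0 :=
    IsPullback.mk' (by simp) (fun T φ φ' h₁ h₂ => by ext <;> assumption)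
      fun T a b _ => ⟨biprod.lift b a, by simp, by simp⟩
  exact hE.conf_of_isPullback (hE.conf_id_zero Y hZ) sq (by simp) (by simp)

lemma inflation_map_left {X Y : C} {i : X ⟶ Y} (hi : Inflation E i) (W : C) :
    Inflation E (biprod.map i (𝟙 W)) :=
  hE.inflation_of_isPushout hi (f := biprod.inl) (f' := biprod.inl)
    (IsPushout.mk' (by simp)
      (fun T φ φ' h₁ h₂ => by
        ext
        · exact h₁
        · simpa using biprod.inr ≫= h₂)
      fun T a b h => ⟨biprod.desc a (biprod.inr ≫ b), by simp, by ext <;> simp [h]⟩)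

lemma inflation_map_right {X Y : C} {i : X ⟶ Y} (hi : Inflation E i) (W : C) :
    Inflation E (biprod.map (𝟙 W) i) :=
  hE.inflation_of_isPushout hi (f := biprod.inr) (f' := biprod.inr)
    (IsPushout.mk' (by simp)
      (fun T φ φ' h₁ h₂ => by
        ext
        · simpa using biprod.inl ≫= h₂
        · exact h₁)
      fun T a b h => ⟨biprod.desc (biprod.inl ≫ b) a, by simp, by ext <;> simp [h]⟩)

lemma deflation_map_right {X Y : C} {p : X ⟶ Y} (hp : Deflation E p) (W : C) :
    Deflation E (biprod.map (𝟙 W) p) :=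
  hE.deflation_of_isPullback hp (f := biprod.snd) (f' := biprod.snd)
    (IsPullback.mk' (by simp)
      (fun T φ φ' h₁ h₂ => by
        ext
        · simpa using h₂ =≫ biprod.fst
        · exact h₁)
      fun T a b h => ⟨biprod.lift (b ≫ biprod.fst) a, by simp, by ext <;> simp [h]⟩)

lemma inflation_map {X Y X' Y' : C} {i : X ⟶ Y} {j : X' ⟶ Y'} (hi : Inflation E i)
    (hj : Inflation E j) : Inflation E (biprod.map i j) := by
  have := hE.inflation_comp _ _ (hE.inflation_map_left hi X') (hE.inflation_map_right hj Y)
  convert this using 1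
  ext <;> simp

/-- The shear automorphism `s` turns this map into `biprod.inr` followed by `biprod.map (𝟙 W) i`.
Dually for `deflation_desc`. -/
lemma inflation_lift {X W I : C} {i : X ⟶ I} (hi : Inflation E i) (u : X ⟶ W) :
    Inflation E (biprod.lift u i) := by
  let s : W ⊞ X ≅ W ⊞ X :=
    { hom := biprod.lift (biprod.desc (𝟙 _) u) biprod.snd
      inv := biprod.lift (biprod.desc (𝟙 _) (-u)) biprod.snd
      hom_inv_id := by ext <;> simp
      inv_hom_id := by ext <;> simp }
  have := s.isIso_hom
  have := hE.inflation_comp _ _ (hE.inflation_comp _ _ (hE.conf_inr_fst W X).inflation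
    (hE.inflation_of_isIso s.hom)) (hE.inflation_map_right hi W)
  convert this using 1
  ext <;> simp [s]

lemma deflation_desc {X Q Y : C} {q : Q ⟶ Y} (hq : Deflation E q) (f : X ⟶ Y) :
    Deflation E (biprod.desc f q) := by
  let s : X ⊞ Y ≅ X ⊞ Y :=
    { hom := biprod.lift biprod.fst (biprod.desc f (𝟙 _))
      inv := biprod.lift biprod.fst (biprod.desc (-f) (𝟙 _))
      hom_inv_id := by ext <;> simp
      inv_hom_id := by ext <;> simp }
  have := s.isIso_hom
  have := hE.deflation_comp _ _ (hE.deflation_map_right hq X)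
    (hE.deflation_comp _ _ (hE.deflation_of_isIso s.hom) (hE.conf_inl_snd X Y).deflation)
  convert this using 1
  ext <;> simp [s]

/-- The inductive step in the construction of deflations onto inflation sequences. -/
lemma exists_deflation_step {K P X X' Q : C} {k : K ⟶ P} {p : P ⟶ X} (h : Conf E k p)
    {x : X ⟶ X'} (hx : Inflation E x) {q : Q ⟶ X'} (hq : Deflation E q) :
    ∃ (K' : C) (k' : K' ⟶ P ⊞ Q) (a : K ⟶ K'), Conf E k' (biprod.desc (p ≫ x) q) ∧
      Inflation E a ∧ a ≫ k' = k ≫ biprod.inl := by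
  obtain ⟨Z, z, hz⟩ := hx.exists_conf
  have := hz.mono hE
  -- In element notation, `(u, v)` lies in the kernel when `x (p u) = -q v`. Then `-v` lies in the
  -- kernel `L` of `q ≫ z`, and the condition becomes `p u = κ (-v)`. So the kernel is the pullback
  -- of `p` along `κ`, and it contains `K` as the kernel of its projection to `L`.
  obtain ⟨L, l, hl⟩ := (hE.deflation_comp _ _ hq hz.deflation).exists_conf
  have := hl.mono hE
  obtain ⟨κ, hκ⟩ := hz.exists_lift hE (l ≫ q) (by simpa using hl.w)
  obtain ⟨K', g, π, a, sq, ha, hag⟩ := hE.exists_pullback h κ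
  refine ⟨K', biprod.lift g (-π ≫ l), a, ?_, ha.inflation, ?_⟩
  · refine hE.conf_of_kernel (hE.deflation_desc hq _) ?_ ⟨fun s t hst => ?_⟩ fun T t ht => ?_
    · simp [reassoc_of% sq.w, hκ]
    · refine sq.hom_ext ?_ ?_
      · simpa using hst =≫ biprod.fst
      · rw [← cancel_mono l]
        simpa only [Category.assoc, biprod.lift_snd, Preadditive.neg_comp, Preadditive.comp_neg,
          neg_inj] using hst =≫ biprod.snd
    · have ht' : t ≫ biprod.fst ≫ p ≫ x + t ≫ biprod.snd ≫ q = 0 := by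
        rw [← ht, biprod.desc_eq]; simp
      obtain ⟨w, hw⟩ := hl.exists_lift hE (t ≫ biprod.snd) (by
        have := ht' =≫ z
        simpa [hz.w] using this)
      have e : (t ≫ biprod.fst) ≫ p = (-w) ≫ κ := by
        rw [← cancel_mono x]
        simp only [Category.assoc, Preadditive.neg_comp, hκ, reassoc_of% hw]
        exact eq_neg_of_add_eq_zero_left ht'
      exact ⟨sq.lift _ _ e, by ext <;> simp [hw]⟩
  · ext <;> simp [hag, reassoc_of% ha.w]

end Biproducts

/-- The inductive step in the construction of inflations from inflation sequences. -/
lemma exists_inflation_step {X X' I Z : C} {i : X ⟶ I} {z : I ⟶ Z} (h : Conf E i z)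
    {x : X ⟶ X'} (hx : Inflation E x)
    (hinj : ∀ Y : C, ∃ (J : C) (j : Y ⟶ J), IsInj E J ∧ Inflation E j) :
    ∃ (I' Z' : C) (i' : X' ⟶ I') (z' : I' ⟶ Z') (a : I ⟶ I') (c : Z ⟶ Z'), IsInj E I' ∧
      Conf E i' z' ∧ x ≫ i' = i ≫ a ∧ z ≫ c = a ≫ z' ∧ Inflation E a ∧ Inflation E c := by
  -- Embedding the pushout `P`, rather than `X'` alone, into an injective makes `I ⟶ J` an
  -- inflation; the map of cokernels is then a pushout of `j`.
  obtain ⟨P, f, i₁, q, sq, hq, hfq⟩ := hE.exists_pushout h x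
  obtain ⟨J, j, hJ, hj⟩ := hinj P
  obtain ⟨V, n, c, sq', hc⟩ := hE.inflation_pushout j q hj
  refine ⟨J, V, i₁ ≫ j, n, f ≫ j, c, hJ, hE.conf_comp_of_isPushout hq hj sq', ?_, ?_,
    hE.inflation_comp _ _ (hE.inflation_of_isPushout hx sq.flip) hj, hc⟩
  · rw [← reassoc_of% sq.w]
  · rw [Category.assoc, sq'.w, reassoc_of% hfq]

end IsExactCategory

end ExactCategory

/-! ### Pointwise lifts, pullbacks and pushouts of functors. -/

section PointwiseConstructions

variable {J : Type*} [Category* J] {C : Type u} [Category.{v} C]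

/-- Pointwise lifts through monomorphisms are unique, hence natural. -/
lemma NatTrans.exists_lift {T X Y : J ⥤ C} (i : X ⟶ Y) (t : T ⟶ Y) (hi : ∀ s, Mono (i.app s))
    (h : ∀ s, ∃ u : T.obj s ⟶ X.obj s, u ≫ i.app s = t.app s) : ∃ u : T ⟶ X, u ≫ i = t := by
  choose u hu using h
  refine ⟨{ app := u, naturality := fun a b φ => ?_ }, by ext s; exact hu s⟩
  rw [← cancel_mono (i.app b)]
  simp [hu, reassoc_of% hu]

lemma NatTrans.exists_desc {T X Y : J ⥤ C} (p : X ⟶ Y) (t : X ⟶ T) (hp : ∀ s, Epi (p.app s))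
    (h : ∀ s, ∃ u : Y.obj s ⟶ T.obj s, p.app s ≫ u = t.app s) : ∃ u : Y ⟶ T, p ≫ u = t := by
  choose u hu using h
  refine ⟨{ app := u, naturality := fun a b φ => ?_ }, by ext s; exact hu s⟩
  rw [← cancel_epi (p.app a)]
  simp [hu, reassoc_of% hu, ← NatTrans.naturality_assoc]

lemma NatTrans.exists_pullback {Y Z Z' : J ⥤ C} (p : Y ⟶ Z) (f : Z' ⟶ Z)
    (h : ∀ s, ∃ (W : C) (f' : W ⟶ Y.obj s) (p' : W ⟶ Z'.obj s),
      IsPullback f' p' (p.app s) (f.app s)) :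
    ∃ (W : J ⥤ C) (f' : W ⟶ Y) (p' : W ⟶ Z'),
      ∀ s, IsPullback (f'.app s) (p'.app s) (p.app s) (f.app s) := by
  choose W f' p' sq using h
  have w {a b : J} (φ : a ⟶ b) :
      (f' a ≫ Y.map φ) ≫ p.app b = (p' a ≫ Z'.map φ) ≫ f.app b := by
    simp [reassoc_of% (sq a).w]
  let W' : J ⥤ C :=
    { obj := W
      map := fun {a b} φ => (sq b).lift (f' a ≫ Y.map φ) (p' a ≫ Z'.map φ) (w φ)
      map_id := fun a => (sq a).hom_ext (by simp) (by simp)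
      map_comp := fun {a b c} φ ψ => (sq c).hom_ext (by simp) (by simp) }
  exact ⟨W', { app := f' }, { app := p' }, sq⟩

lemma NatTrans.exists_pushout {X Y X' : J ⥤ C} (i : X ⟶ Y) (f : X ⟶ X')
    (h : ∀ s, ∃ (W : C) (f' : Y.obj s ⟶ W) (i' : X'.obj s ⟶ W),
      IsPushout (i.app s) (f.app s) f' i') :
    ∃ (W : J ⥤ C) (f' : Y ⟶ W) (i' : X' ⟶ W),
      ∀ s, IsPushout (i.app s) (f.app s) (f'.app s) (i'.app s) := by
  choose W f' i' sq using h
  have w {a b : J} (φ : a ⟶ b) :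
      i.app a ≫ (Y.map φ ≫ f' b) = f.app a ≫ (X'.map φ ≫ i' b) := by
    simp only [← NatTrans.naturality_assoc, (sq b).w]
  let W' : J ⥤ C :=
    { obj := W
      map := fun {a b} φ => (sq a).desc (Y.map φ ≫ f' b) (X'.map φ ≫ i' b) (w φ)
      map_id := fun a => (sq a).hom_ext (by simp) (by simp)
      map_comp := fun {a b c} φ ψ => (sq a).hom_ext (by simp) (by simp) }
  exact ⟨W', { app := f', naturality := fun a b φ => ((sq a).inl_desc _ _ _).symm },
    { app := i', naturality := fun a b φ => ((sq a).inr_desc _ _ _).symm }, sq⟩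

end PointwiseConstructions

/-! ### The exact structure on inflation sequences. -/

section InfExact

variable {A : Type u} [Category.{v} A] [Preadditive A] {E : ObjectProperty (ShortComplex A)}
  {n : ℕ}

lemma Inf.hom_ext {X Y : Inf E n} {f g : X ⟶ Y} (h : ∀ s, f.hom.app s = g.hom.app s) : f = g := by
  apply ObjectProperty.hom_ext
  ext s
  exact h s

@[simp] lemma Inf.sub_app {X Y : Inf E n} (f g : X ⟶ Y) (s : Fin n) :
    (f - g).hom.app s = f.hom.app s - g.hom.app s :=
  (Inf.component E n s).map_sub

lemma Inf.mono_of_app {X Y : Inf E n} {i : X ⟶ Y} (hi : ∀ s, Mono (i.hom.app s)) : Mono i :=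
  ⟨fun g h e => Inf.hom_ext fun s => by
    rw [← cancel_mono (i.hom.app s)]
    exact congr_arg (fun f => f.hom.app s) e⟩

lemma Inf.epi_of_app {X Y : Inf E n} {p : X ⟶ Y} (hp : ∀ s, Epi (p.hom.app s)) : Epi p :=
  ⟨fun g h e => Inf.hom_ext fun s => by
    rw [← cancel_epi (p.hom.app s)]
    exact congr_arg (fun f => f.hom.app s) e⟩

lemma conf_inf_iff {X Y Z : Inf E n} {i : X ⟶ Y} {p : Y ⟶ Z} :
    Conf (infConflations E n) i p ↔ ∀ s, Conf E (i.hom.app s) (p.hom.app s) := by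
  constructor
  · rintro ⟨w, h⟩ s
    exact ⟨congr_arg (fun f => f.hom.app s) w, h s⟩
  · intro h
    exact ⟨Inf.hom_ext fun s => (h s).w, fun s => (h s).2⟩

lemma Inflation.app {X Y : Inf E n} {i : X ⟶ Y} (hi : Inflation (infConflations E n) i)
    (s : Fin n) : Inflation E (i.hom.app s) :=
  let ⟨_, _, h⟩ := hi.exists_conf
  (conf_inf_iff.1 h s).inflation

lemma Deflation.app {X Y : Inf E n} {p : X ⟶ Y} (hp : Deflation (infConflations E n) p)
    (s : Fin n) : Deflation E (p.hom.app s) :=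
  let ⟨_, _, h⟩ := hp.exists_conf
  (conf_inf_iff.1 h s).deflation

namespace IsExactCategory

variable (hE : IsExactCategory E)
include hE

/-- Inflation sequences are closed under pointwise extensions. -/
lemma isInflationSeq_of_conf {X Y Z : Fin n ⥤ A} {i : X ⟶ Y} {p : Y ⟶ Z}
    (h : ∀ s, Conf E (i.app s) (p.app s)) (hX : isInflationSeq E n X)
    (hZ : isInflationSeq E n Z) : isInflationSeq E n Y := fun s hs =>
  hE.inflation_of_conf (h _) (h _) (i.naturality _).symm (p.naturality _).symm
    (hX s hs) (hZ s hs)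

lemma exists_inf_pullback {X Y Z Z' : Inf E n} {i : X ⟶ Y} {p : Y ⟶ Z}
    (h : Conf (infConflations E n) i p) (f : Z' ⟶ Z) :
    ∃ (Y' : Inf E n) (f' : Y' ⟶ Y) (p' : Y' ⟶ Z') (i' : X ⟶ Y'),
      IsPullback f' p' p f ∧ Conf (infConflations E n) i' p' ∧ i' ≫ f' = i ∧
      ∀ s, IsPullback (f'.hom.app s) (p'.hom.app s) (p.hom.app s) (f.hom.app s) := by
  have h' := conf_inf_iff.1 h
  obtain ⟨W, f', p', sq⟩ := NatTrans.exists_pullback p.hom f.hom fun s =>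
    let ⟨W, f', p', _, sq, _⟩ := hE.exists_pullback (h' s) (f.hom.app s)
    ⟨W, f', p', sq⟩
  have SQ := IsPullback.of_forall_isPullback_app sq
  have w : i.hom ≫ p.hom = 0 ≫ f.hom := by
    ext s
    simp [(h' s).w]
  have hl := SQ.lift_fst i.hom 0 w
  have hr := SQ.lift_snd i.hom 0 w
  have hc : ∀ s, Conf E ((SQ.lift i.hom 0 w).app s) (p'.app s) := fun s =>
    hE.conf_of_isPullback (h' s) (sq s) (congr_arg (fun f => f.app s) hl)
      (congr_arg (fun f => f.app s) hr)
  let Y' : Inf E n := ⟨W, hE.isInflationSeq_of_conf hc X.property Z'.property⟩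
  refine ⟨Y', ObjectProperty.homMk f', ObjectProperty.homMk p',
    ObjectProperty.homMk (SQ.lift i.hom 0 w), ?_, conf_inf_iff.2 hc, ?_, sq⟩
  · exact IsPullback.of_map_of_faithful (isInflationSeq E n).ι SQ
  · exact ObjectProperty.hom_ext _ hl

lemma exists_inf_pushout {X Y Z X' : Inf E n} {i : X ⟶ Y} {p : Y ⟶ Z}
    (h : Conf (infConflations E n) i p) (f : X ⟶ X') :
    ∃ (Y' : Inf E n) (f' : Y ⟶ Y') (i' : X' ⟶ Y') (p' : Y' ⟶ Z),
      IsPushout i f f' i' ∧ Conf (infConflations E n) i' p' ∧ f' ≫ p' = p ∧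
      ∀ s, IsPushout (i.hom.app s) (f.hom.app s) (f'.hom.app s) (i'.hom.app s) := by
  have h' := conf_inf_iff.1 h
  obtain ⟨W, f', i', sq⟩ := NatTrans.exists_pushout i.hom f.hom fun s =>
    let ⟨W, f', i', _, sq, _⟩ := hE.exists_pushout (h' s) (f.hom.app s)
    ⟨W, f', i', sq⟩
  have SQ := IsPushout.of_forall_isPushout_app sq
  have w : i.hom ≫ p.hom = f.hom ≫ 0 := by
    ext s
    simp [(h' s).w]
  have hl := SQ.inl_desc p.hom 0 w
  have hr := SQ.inr_desc p.hom 0 w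
  have hc : ∀ s, Conf E (i'.app s) ((SQ.desc p.hom 0 w).app s) := fun s =>
    hE.conf_of_isPushout (h' s) (sq s) (congr_arg (fun f => f.app s) hl)
      (congr_arg (fun f => f.app s) hr)
  let Y' : Inf E n := ⟨W, hE.isInflationSeq_of_conf hc X'.property Z.property⟩
  refine ⟨Y', ObjectProperty.homMk f', ObjectProperty.homMk i',
    ObjectProperty.homMk (SQ.desc p.hom 0 w), ?_, conf_inf_iff.2 hc, ?_, sq⟩
  · exact IsPushout.of_map_of_faithful (isInflationSeq E n).ι SQ
  · exact ObjectProperty.hom_ext _ hl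

lemma exists_inf_isZero : ∃ Z : Inf E n, IsZero Z ∧ ∀ s, IsZero (Z.obj.obj s) := by
  obtain ⟨Z, hZ⟩ := hE.hasZeroObject
  let Z' : Inf E n := ⟨(Functor.const _).obj Z, fun s hs => hE.inflation_id Z⟩
  have hZ' : 𝟙 Z' = 0 := Inf.hom_ext fun s => hZ.eq_of_src _ _
  exact ⟨Z', (IsZero.iff_id_eq_zero _).2 hZ', fun _ => hZ⟩

lemma inf_hasBinaryBiproducts : HasBinaryBiproducts (Inf E n) := by
  have := hE.hasBinaryBiproducts
  refine ⟨fun X Y => ?_⟩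
  let W : Inf E n :=
    ⟨{ obj := fun s => X.obj.obj s ⊞ Y.obj.obj s
       map := fun φ => biprod.map (X.obj.map φ) (Y.obj.map φ)
       map_id := fun s => by ext <;> simp
       map_comp := fun φ ψ => by ext <;> simp },
      fun s hs => hE.inflation_map (X.property s hs) (Y.property s hs)⟩
  let b : BinaryBicone X Y :=
    { pt := W
      fst := ObjectProperty.homMk { app := fun s => biprod.fst }
      snd := ObjectProperty.homMk { app := fun s => biprod.snd }
      inl := ObjectProperty.homMk { app := fun s => biprod.inl }
      inr := ObjectProperty.homMk { app := fun s => biprod.inr }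
      inl_fst := Inf.hom_ext fun s => biprod.inl_fst
      inl_snd := Inf.hom_ext fun s => biprod.inl_snd
      inr_fst := Inf.hom_ext fun s => biprod.inr_fst
      inr_snd := Inf.hom_ext fun s => biprod.inr_snd }
  exact HasBinaryBiproduct.mk ⟨b, isBinaryBilimitOfTotal b (Inf.hom_ext fun s => biprod.total)⟩

/-- Each axiom is inherited pointwise. The new objects are extensions of inflation sequences, hence
inflation sequences themselves. -/
theorem inf (n : ℕ) : IsExactCategory (infConflations E n) where
  hasZeroObject := let ⟨Z, hZ, _⟩ := hE.exists_inf_isZero; ⟨Z, hZ⟩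
  hasBinaryBiproducts := hE.inf_hasBinaryBiproducts
  of_iso e h s := hE.of_iso ((Inf.component E n s).mapShortComplex.mapIso e) (h s)
  isKernel S hS := by
    have hc : ∀ s, Conf E (S.f.hom.app s) (S.g.hom.app s) := conf_inf_iff.1 ⟨S.zero, hS⟩
    have := Inf.mono_of_app fun s => (hc s).mono hE
    have hl {T : Inf E n} (t : T ⟶ S.X₂) (ht : t ≫ S.g = 0) : ∃ u : T ⟶ S.X₁, u ≫ S.f = t := by
      obtain ⟨u, hu⟩ := NatTrans.exists_lift S.f.hom t.hom (fun s => (hc s).mono hE) fun s =>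
        (hc s).exists_lift hE _ (congr_arg (fun f => f.hom.app s) ht)
      exact ⟨ObjectProperty.homMk u, ObjectProperty.hom_ext _ hu⟩
    exact ⟨KernelFork.IsLimit.ofι' _ _ fun t ht => ⟨_, (hl t ht).choose_spec⟩⟩
  isCokernel S hS := by
    have hc : ∀ s, Conf E (S.f.hom.app s) (S.g.hom.app s) := conf_inf_iff.1 ⟨S.zero, hS⟩
    have := Inf.epi_of_app fun s => (hc s).epi hE
    have hl {T : Inf E n} (t : S.X₂ ⟶ T) (ht : S.f ≫ t = 0) : ∃ u : S.X₃ ⟶ T, S.g ≫ u = t := by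
      obtain ⟨u, hu⟩ := NatTrans.exists_desc S.g.hom t.hom (fun s => (hc s).epi hE) fun s =>
        (hc s).exists_desc hE _ (congr_arg (fun f => f.hom.app s) ht)
      exact ⟨ObjectProperty.homMk u, ObjectProperty.hom_ext _ hu⟩
    exact ⟨CokernelCofork.IsColimit.ofπ' _ _ fun t ht => ⟨_, (hl t ht).choose_spec⟩⟩
  inflation_id X := by
    obtain ⟨Z, -, hZ⟩ := hE.exists_inf_isZero (n := n)
    exact (conf_inf_iff.2 fun s => hE.conf_id_zero _ (hZ s) : Conf _ (𝟙 X) (0 : X ⟶ Z)).inflation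
  deflation_id X := by
    obtain ⟨Z, -, hZ⟩ := hE.exists_inf_isZero (n := n)
    exact (conf_inf_iff.2 fun s => hE.conf_zero_id _ (hZ s) : Conf _ (0 : Z ⟶ X) (𝟙 X)).deflation
  inflation_comp i j hi hj := by
    obtain ⟨Z, p, h⟩ := hi.exists_conf
    obtain ⟨V, q, h'⟩ := hj.exists_conf
    -- The cokernel of `i ≫ j` is the pushout of `j` along `p`, an extension of `V` by `Z`.
    obtain ⟨W, n, k, r, -, -, -, sq⟩ := hE.exists_inf_pushout h' p
    exact (conf_inf_iff.2 fun s => hE.conf_comp_of_isPushout (conf_inf_iff.1 h s) (hj.app s)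
      (sq s) : Conf _ (i ≫ j) n).inflation
  deflation_comp p q hp hq := by
    obtain ⟨Z, i, h⟩ := hp.exists_conf
    obtain ⟨V, j, h'⟩ := hq.exists_conf
    obtain ⟨W, n, k, r, -, -, -, sq⟩ := hE.exists_inf_pullback h j
    exact (conf_inf_iff.2 fun s => hE.conf_comp_of_isPullback (conf_inf_iff.1 h' s) (hp.app s)
      (sq s) : Conf _ n (p ≫ q)).deflation
  inflation_pushout i f hi := by
    obtain ⟨Z, p, h⟩ := hi.exists_conf
    obtain ⟨W, f', i', r, sq, h', -⟩ := hE.exists_inf_pushout h f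
    exact ⟨W, f', i', sq, h'.inflation⟩
  deflation_pullback p f hp := by
    obtain ⟨Z, i, h⟩ := hp.exists_conf
    obtain ⟨W, f', p', r, sq, h', -⟩ := hE.exists_inf_pullback h f
    exact ⟨W, f', p', sq, h'.deflation⟩

end IsExactCategory

end InfExact

/-! ### Recursive construction along a finite chain. -/

section Sequences

lemma exists_fin_seq {m : ℕ} {σ : Fin (m + 1) → Type*}
    (R : ∀ k : Fin m, σ k.castSucc → σ k.succ → Prop) (h₀ : Nonempty (σ 0))
    (h : ∀ (k : Fin m) (t : σ k.castSucc), ∃ t' : σ k.succ, R k t t') :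
    ∃ t : ∀ s, σ s, ∀ k : Fin m, R k (t k.castSucc) (t k.succ) := by
  choose next hnext using h
  exact ⟨fun s => Fin.induction h₀.some next s, fun k => hnext k _⟩

/-- The morphism in `Fin (m + 1)` from the `k`-th element to its successor. -/
abbrev succHom {m : ℕ} (k : Fin m) : k.castSucc ⟶ k.succ := homOfLE (Fin.castSucc_lt_succ).le

variable {m : ℕ} {C : Type u} [Category.{v} C]

/-- Construct a natural transformation between sequences from its components, checking
naturality on consecutive objects. -/
def natTransOfSucc {X Y : Fin (m + 1) ⥤ C} (f : ∀ s, X.obj s ⟶ Y.obj s)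
    (h : ∀ k : Fin m, X.map (succHom k) ≫ f k.succ = f k.castSucc ≫ Y.map (succHom k)) :
    X ⟶ Y :=
  ComposableArrows.homMk (F := X) (G := Y) f fun k hk => h ⟨k, hk⟩

lemma mkOfObjOfMapSucc_map_succHom (X : Fin (m + 1) → C)
    (x : ∀ k : Fin m, X k.castSucc ⟶ X k.succ) (k : Fin m) :
    (ComposableArrows.mkOfObjOfMapSucc X x).map (succHom k) = x k :=
  ComposableArrows.mkOfObjOfMapSucc_map_succ X x k k.2

variable [Preadditive C] {E : ObjectProperty (ShortComplex C)}

lemma isInflationSeq_iff {X : Fin (m + 1) ⥤ C} :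
    isInflationSeq E (m + 1) X ↔ ∀ k : Fin m, Inflation E (X.map (succHom k)) :=
  ⟨fun h k => h k (Nat.succ_lt_succ k.2), fun h s hs => h ⟨s, Nat.lt_of_succ_lt_succ hs⟩⟩

end Sequences

/-! ### Projective and injective inflation sequences. -/

section Frobenius

section ProjInj

variable {C : Type u} [Category.{v} C] [Preadditive C] {E : ObjectProperty (ShortComplex C)}

lemma IsProj.biprod [HasBinaryBiproducts C] {P Q : C} (hP : IsProj E P) (hQ : IsProj E Q) :
    IsProj E (P ⊞ Q) := by
  intro Y Z p hp f
  obtain ⟨g₁, h₁⟩ := hP p hp (biprod.inl ≫ f)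
  obtain ⟨g₂, h₂⟩ := hQ p hp (biprod.inr ≫ f)
  exact ⟨biprod.desc g₁ g₂, by ext <;> simp [h₁, h₂]⟩

lemma IsProj.of_retract {P Q : C} (hP : IsProj E P) (s : Q ⟶ P) (r : P ⟶ Q) (h : s ≫ r = 𝟙 Q) :
    IsProj E Q := by
  intro Y Z p hp f
  obtain ⟨g, hg⟩ := hP p hp (r ≫ f)
  exact ⟨s ≫ g, by rw [Category.assoc, hg, reassoc_of% h]⟩

lemma IsInj.of_retract {P Q : C} (hP : IsInj E P) (s : Q ⟶ P) (r : P ⟶ Q) (h : s ≫ r = 𝟙 Q) :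
    IsInj E Q := by
  intro X Y i hi f
  obtain ⟨g, hg⟩ := hP i hi (f ≫ s)
  exact ⟨g ≫ r, by rw [reassoc_of% hg, h, Category.comp_id]⟩

end ProjInj

variable {A : Type u} [Category.{v} A] [Preadditive A] {E : ObjectProperty (ShortComplex A)}
  {m : ℕ}

/-- At the next index the extension is prescribed on `U` by `f` and on the image of `V` by
naturality, that is, on the pushout of the two. The corner map out of this pushout is an inflation
because the cokernel `W` is an inflation sequence. -/
lemma IsExactCategory.isInj_inf_of_forall (hE : IsExactCategory E) {X : Inf E (m + 1)}
    (hX : ∀ s, IsInj E (X.obj.obj s)) : IsInj (infConflations E (m + 1)) X := by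
  intro U V i hi f
  obtain ⟨W, p, h⟩ := hi.exists_conf
  have hc := conf_inf_iff.1 h
  obtain ⟨t, ht⟩ := exists_fin_seq
    (σ := fun s => {g : V.obj.obj s ⟶ X.obj.obj s // i.hom.app s ≫ g = f.hom.app s})
    (fun k g g' => V.obj.map (succHom k) ≫ g'.1 = g.1 ≫ X.obj.map (succHom k))
    (by
      obtain ⟨g, hg⟩ := hX 0 _ (hi.app 0) (f.hom.app 0)
      exact ⟨g, hg⟩)
    (by
      rintro k ⟨g, hg⟩
      obtain ⟨P, b, j, -, sq, -⟩ := hE.exists_pushout (hc k.castSucc) (U.obj.map (succHom k))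
      have hd := hE.inflation_corner (hc k.castSucc) (hc k.succ) (p.hom.naturality (succHom k)).symm
        (isInflationSeq_iff.1 W.property k) sq
        (d := sq.desc (V.obj.map (succHom k)) (i.hom.app k.succ) (i.hom.naturality _).symm)
        (by simp) (by simp)
      obtain ⟨e, he⟩ := hX k.succ _ hd (sq.desc (g ≫ X.obj.map (succHom k)) (f.hom.app k.succ)
        (by rw [reassoc_of% hg, f.hom.naturality]))
      exact ⟨⟨e, by simpa using j ≫= he⟩, by simpa using b ≫= he⟩)
  exact ⟨ObjectProperty.homMk (natTransOfSucc (fun s => (t s).1) ht),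
    Inf.hom_ext fun s => (t s).2⟩

lemma isProj_inf_of_forall {X : Inf E (m + 1)} (hX : ∀ s, IsInj E (X.obj.obj s))
    (hX' : ∀ s, IsProj E (X.obj.obj s)) : IsProj (infConflations E (m + 1)) X := by
  intro V W p hp f
  obtain ⟨t, ht⟩ := exists_fin_seq
    (σ := fun s => {g : X.obj.obj s ⟶ V.obj.obj s // g ≫ p.hom.app s = f.hom.app s})
    (fun k g g' => X.obj.map (succHom k) ≫ g'.1 = g.1 ≫ V.obj.map (succHom k))
    (by
      obtain ⟨g, hg⟩ := hX' 0 _ (hp.app 0) (f.hom.app 0)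
      exact ⟨g, hg⟩)
    (by
      rintro k ⟨g, hg⟩
      obtain ⟨h, hh⟩ := hX' k.succ _ (hp.app k.succ) (f.hom.app k.succ)
      obtain ⟨r, hr⟩ := hX k.castSucc _ (isInflationSeq_iff.1 X.property k) (𝟙 _)
      -- The structure map is split by `r`. An arbitrary lift `h` is used only on the complement,
      -- and the part through `r` is dictated by naturality.
      refine ⟨⟨r ≫ g ≫ V.obj.map (succHom k) + (𝟙 _ - r ≫ X.obj.map (succHom k)) ≫ h, ?_⟩, ?_⟩
      · simp [hh, reassoc_of% hg]
      · simp [reassoc_of% hr])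
  exact ⟨ObjectProperty.homMk (natTransOfSucc (fun s => (t s).1) ht),
    Inf.hom_ext fun s => (t s).2⟩

/-- The kernels are carried through the recursion, since a deflation of `Inf` requires them to form
an inflation sequence too. -/
lemma IsFrobeniusCategory.exists_inf_deflation (hE : IsFrobeniusCategory E) (X : Inf E (m + 1)) :
    ∃ (P : Inf E (m + 1)) (p : P ⟶ X), (∀ s, IsProj E (P.obj.obj s)) ∧
      Deflation (infConflations E (m + 1)) p := by
  have := hE.exact.hasBinaryBiproducts
  obtain ⟨t, ht⟩ := exists_fin_seq
    (σ := fun s => Σ (P K : A), {d : (P ⟶ X.obj.obj s) × (K ⟶ P) // Conf E d.2 d.1 ∧ IsProj E P})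
    (fun k t t' => ∃ (a : t.2.1 ⟶ t'.2.1) (b : t.1 ⟶ t'.1), Inflation E a ∧ Inflation E b ∧
      a ≫ t'.2.2.1.2 = t.2.2.1.2 ≫ b ∧ b ≫ t'.2.2.1.1 = t.2.2.1.1 ≫ X.obj.map (succHom k))
    (by
      obtain ⟨P, p, hP, hp⟩ := hE.enough_projectives (X.obj.obj 0)
      obtain ⟨K, k, h⟩ := hp.exists_conf
      exact ⟨P, K, ⟨(p, k), h, hP⟩⟩)
    (by
      rintro k ⟨P, K, ⟨p, l⟩, h, hP⟩
      obtain ⟨Q, q, hQ, hq⟩ := hE.enough_projectives (X.obj.obj k.succ)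
      obtain ⟨K', k', a, hc, ha, hak⟩ :=
        hE.exact.exists_deflation_step h (isInflationSeq_iff.1 X.property k) hq
      exact ⟨⟨P ⊞ Q, K', ⟨(_, k'), hc, hP.biprod hQ⟩⟩, a, biprod.inl, ha,
        (hE.exact.conf_inl_snd P Q).inflation, hak, biprod.inl_desc _ _⟩)
  choose a b ha hb hk hp using ht
  let K : Inf E (m + 1) :=
    ⟨ComposableArrows.mkOfObjOfMapSucc (fun s => (t s).2.1) a, isInflationSeq_iff.2 fun k => by
      rw [mkOfObjOfMapSucc_map_succHom]; exact ha k⟩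
  let P : Inf E (m + 1) :=
    ⟨ComposableArrows.mkOfObjOfMapSucc (fun s => (t s).1) b, isInflationSeq_iff.2 fun k => by
      rw [mkOfObjOfMapSucc_map_succHom]; exact hb k⟩
  let i : K ⟶ P := ObjectProperty.homMk (natTransOfSucc (fun s => (t s).2.2.1.2) fun k => by
    dsimp only [K, P]
    rw [mkOfObjOfMapSucc_map_succHom, mkOfObjOfMapSucc_map_succHom]; exact hk k)
  let p : P ⟶ X := ObjectProperty.homMk (natTransOfSucc (fun s => (t s).2.2.1.1) fun k => by
    dsimp only [P]
    rw [mkOfObjOfMapSucc_map_succHom]; exact hp k)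
  have hc : Conf (infConflations E (m + 1)) i p := conf_inf_iff.2 fun s => (t s).2.2.2.1
  exact ⟨P, p, fun s => (t s).2.2.2.2, hc.deflation⟩

lemma IsFrobeniusCategory.exists_inf_inflation (hE : IsFrobeniusCategory E) (X : Inf E (m + 1)) :
    ∃ (I : Inf E (m + 1)) (i : X ⟶ I), (∀ s, IsInj E (I.obj.obj s)) ∧
      Inflation (infConflations E (m + 1)) i := by
  obtain ⟨t, ht⟩ := exists_fin_seq
    (σ := fun s => Σ (I Z : A), {d : (X.obj.obj s ⟶ I) × (I ⟶ Z) // Conf E d.1 d.2 ∧ IsInj E I})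
    (fun k t t' => ∃ (a : t.1 ⟶ t'.1) (b : t.2.1 ⟶ t'.2.1), Inflation E a ∧ Inflation E b ∧
      X.obj.map (succHom k) ≫ t'.2.2.1.1 = t.2.2.1.1 ≫ a ∧ a ≫ t'.2.2.1.2 = t.2.2.1.2 ≫ b)
    (by
      obtain ⟨I, i, hI, hi⟩ := hE.enough_injectives (X.obj.obj 0)
      obtain ⟨Z, z, h⟩ := hi.exists_conf
      exact ⟨I, Z, ⟨(i, z), h, hI⟩⟩)
    (by
      rintro k ⟨I, Z, ⟨i, z⟩, h, hI⟩
      obtain ⟨I', Z', i', z', a, c, hI', hc, h₁, h₂, ha, hc'⟩ := hE.exact.exists_inflation_step h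
        (isInflationSeq_iff.1 X.property k) hE.enough_injectives
      exact ⟨⟨I', Z', ⟨(i', z'), hc, hI'⟩⟩, a, c, ha, hc', h₁, h₂.symm⟩)
  choose a b ha hb hi hz using ht
  let I : Inf E (m + 1) :=
    ⟨ComposableArrows.mkOfObjOfMapSucc (fun s => (t s).1) a, isInflationSeq_iff.2 fun k => by
      rw [mkOfObjOfMapSucc_map_succHom]; exact ha k⟩
  let Z : Inf E (m + 1) :=
    ⟨ComposableArrows.mkOfObjOfMapSucc (fun s => (t s).2.1) b, isInflationSeq_iff.2 fun k => by
      rw [mkOfObjOfMapSucc_map_succHom]; exact hb k⟩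
  let i : X ⟶ I := ObjectProperty.homMk (natTransOfSucc (fun s => (t s).2.2.1.1) fun k => by
    dsimp only [I]
    rw [mkOfObjOfMapSucc_map_succHom]; exact hi k)
  let z : I ⟶ Z := ObjectProperty.homMk (natTransOfSucc (fun s => (t s).2.2.1.2) fun k => by
    dsimp only [I, Z]
    rw [mkOfObjOfMapSucc_map_succHom, mkOfObjOfMapSucc_map_succHom]; exact hz k)
  have hc : Conf (infConflations E (m + 1)) i z := conf_inf_iff.2 fun s => (t s).2.2.2.1
  exact ⟨I, i, fun s => (t s).2.2.2.2, hc.inflation⟩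

/-- A projective sequence is a retract of the pointwise projective one that covers it. -/
lemma IsFrobeniusCategory.isProj_inf_iff (hE : IsFrobeniusCategory E) {X : Inf E (m + 1)} :
    IsProj (infConflations E (m + 1)) X ↔ ∀ s, IsProj E (X.obj.obj s) := by
  refine ⟨fun h s => ?_,
    fun h => isProj_inf_of_forall (fun s => (hE.proj_iff_inj _).1 (h s)) h⟩
  obtain ⟨P, p, hP, hp⟩ := hE.exists_inf_deflation X
  obtain ⟨g, hg⟩ := h p hp (𝟙 X)
  exact (hP s).of_retract (g.hom.app s) (p.hom.app s) (congr_arg (fun f => f.hom.app s) hg)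

lemma IsFrobeniusCategory.isInj_inf_iff (hE : IsFrobeniusCategory E) {X : Inf E (m + 1)} :
    IsInj (infConflations E (m + 1)) X ↔ ∀ s, IsInj E (X.obj.obj s) := by
  refine ⟨fun h s => ?_, hE.exact.isInj_inf_of_forall⟩
  obtain ⟨I, i, hI, hi⟩ := hE.exists_inf_inflation X
  obtain ⟨g, hg⟩ := h i hi (𝟙 X)
  exact (hI s).of_retract (i.hom.app s) (g.hom.app s) (congr_arg (fun f => f.hom.app s) hg)

theorem IsFrobeniusCategory.inf (hE : IsFrobeniusCategory E) :
    IsFrobeniusCategory (infConflations E (m + 1)) where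
  exact := hE.exact.inf _
  enough_projectives X :=
    let ⟨P, p, hP, hp⟩ := hE.exists_inf_deflation X
    ⟨P, p, hE.isProj_inf_iff.2 hP, hp⟩
  enough_injectives X :=
    let ⟨I, i, hI, hi⟩ := hE.exists_inf_inflation X
    ⟨I, i, hE.isInj_inf_iff.2 hI, hi⟩
  proj_iff_inj X := by
    rw [hE.isProj_inf_iff, hE.isInj_inf_iff]
    exact forall_congr' fun s => hE.proj_iff_inj _

end Frobenius

/-! ### Stable isomorphisms and projective kernels. -/

section Stable

variable {C : Type u} [Category.{v} C] [Preadditive C] {E : ObjectProperty (ShortComplex C)}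

/-- The morphism `f` becomes an isomorphism in the stable category. -/
def StIso (E : ObjectProperty (ShortComplex C)) {X Y : C} (f : X ⟶ Y) : Prop :=
  ∃ g : Y ⟶ X, stableRel E (f ≫ g) (𝟙 X) ∧ stableRel E (g ≫ f) (𝟙 Y)

lemma stableRel.add_left {X Y : C} {f g : X ⟶ Y} (h : stableRel E f g) (k : X ⟶ Y) :
    stableRel E (f + k) (g + k) := by
  obtain ⟨P, a, b, hP, e⟩ := h
  exact ⟨P, a, b, hP, by rw [← e]; abel⟩

lemma stableRel_of_factor {X Y P : C} (hP : IsProj E P) {f g : X ⟶ Y} (a : X ⟶ P) (b : P ⟶ Y)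
    (h : f - g = a ≫ b) : stableRel E f g := ⟨P, a, b, hP, h⟩

namespace IsExactCategory

variable (hE : IsExactCategory E)
include hE

lemma stableRel_refl {X Y : C} (f : X ⟶ Y) : stableRel E f f :=
  hE.congruence_stableRel.equivalence.refl f

lemma stableRel_symm {X Y : C} {f g : X ⟶ Y} (h : stableRel E f g) : stableRel E g f :=
  hE.congruence_stableRel.equivalence.symm h

lemma stableRel_trans {X Y : C} {f g k : X ⟶ Y} (h : stableRel E f g) (h' : stableRel E g k) :
    stableRel E f k :=
  hE.congruence_stableRel.equivalence.trans h h'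

lemma stableRel_comp_left {X Y Z : C} (f : X ⟶ Y) {g g' : Y ⟶ Z} (h : stableRel E g g') :
    stableRel E (f ≫ g) (f ≫ g') := by
  have := hE.congruence_stableRel
  exact HomRel.comp_left f h

lemma stableRel_comp_right {X Y Z : C} {f f' : X ⟶ Y} (g : Y ⟶ Z) (h : stableRel E f f') :
    stableRel E (f ≫ g) (f' ≫ g) := by
  have := hE.congruence_stableRel
  exact HomRel.comp_right g h

lemma functor_map_eq_iff {X Y : C} (f g : X ⟶ Y) :
    (Quotient.functor (stableRel E)).map f = (Quotient.functor (stableRel E)).map g ↔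
      stableRel E f g := by
  have := hE.congruence_stableRel
  exact Quotient.functor_map_eq_iff _ f g

lemma stIso_iff {X Y : C} (f : X ⟶ Y) :
    StIso E f ↔ IsIso ((Quotient.functor (stableRel E)).map f) := by
  constructor
  · rintro ⟨g, h₁, h₂⟩
    refine ⟨(Quotient.functor (stableRel E)).map g, ?_, ?_⟩
    · rw [← Functor.map_comp, ← CategoryTheory.Functor.map_id, hE.functor_map_eq_iff]
      exact h₁
    · rw [← Functor.map_comp, ← CategoryTheory.Functor.map_id, hE.functor_map_eq_iff]
      exact h₂
  · rintro ⟨g, h₁, h₂⟩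
    obtain ⟨g, rfl⟩ := (Quotient.functor (stableRel E)).map_surjective g
    rw [← Functor.map_comp, ← CategoryTheory.Functor.map_id, hE.functor_map_eq_iff] at h₁ h₂
    exact ⟨g, h₁, h₂⟩

lemma stIso_of_stableRel_comp {X Y Z : C} {f : X ⟶ Y} {g : Y ⟶ Z} {k : X ⟶ Z}
    (hf : StIso E f) (hg : StIso E g) (h : stableRel E k (f ≫ g)) : StIso E k := by
  rw [hE.stIso_iff] at *
  rw [(hE.functor_map_eq_iff _ _).2 h, Functor.map_comp]
  infer_instance

/-- If the deflation `d : M ⟶ Y`, where `M` is the sum of `T` and a projective object `P`, restricts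
to a stable isomorphism on `T`, then its kernel is projective. -/
lemma isProj_of_stIso {L M T P Y : C} {ι : L ⟶ M} {d : M ⟶ Y} (h : Conf E ι d) (hP : IsProj E P)
    {fst : M ⟶ T} {snd : M ⟶ P} {inl : T ⟶ M} {inr : P ⟶ M}
    (total : fst ≫ inl + snd ≫ inr = 𝟙 M) (hp : Deflation E (inr ≫ d))
    (hφ : StIso E (inl ≫ d)) : IsProj E L := by
  have := hE.hasBinaryBiproducts
  have := h.mono hE
  obtain ⟨ψ, ⟨Q', a', b', hQ', h'⟩, ⟨Q, a, b, hQ, e⟩⟩ := hφ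
  -- Lifting the error term `b` along the deflation on `P` turns the stable section `ψ ≫ inl` into a
  -- strict section of `d`, so `L` is a retract of `M`.
  obtain ⟨c, hc⟩ := hQ _ hp b
  have hσ : (ψ ≫ inl - a ≫ c ≫ inr) ≫ d = 𝟙 Y := by
    simp only [Preadditive.sub_comp, Category.assoc, hc, ← e]
    abel
  obtain ⟨ρ, hρ⟩ := h.exists_lift hE (𝟙 M - d ≫ (ψ ≫ inl - a ≫ c ≫ inr))
    (by rw [Preadditive.sub_comp, Category.assoc, hσ]; simp)
  have hιρ : ι ≫ ρ = 𝟙 L := by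
    rw [← cancel_mono ι, Category.assoc, hρ, Preadditive.comp_sub, reassoc_of% h.w]
    simp
  have h₀ : ι ≫ fst ≫ inl ≫ d + ι ≫ snd ≫ inr ≫ d = 0 := by
    have := ι ≫= total =≫ d
    simpa [h.w] using this
  have h₁ : ι ≫ fst ≫ inl ≫ d ≫ ψ - ι ≫ fst = ι ≫ fst ≫ a' ≫ b' := by
    rw [← h']
    simp
  have h₂ : ι ≫ fst ≫ inl ≫ d ≫ ψ + ι ≫ snd ≫ inr ≫ d ≫ ψ = 0 := by
    simpa using h₀ =≫ ψ
  have h₃ : ι ≫ fst ≫ inl ≫ ρ + ι ≫ snd ≫ inr ≫ ρ = 𝟙 L := by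
    have := ι ≫= total =≫ ρ
    simpa [hιρ] using this
  -- The `T`-component of `ι` factors through `Q'` and `P`; hence so does `𝟙 L`.
  have h₄ : ι ≫ fst = -(ι ≫ snd ≫ inr ≫ d ≫ ψ) - ι ≫ fst ≫ a' ≫ b' := by
    rw [← h₁, eq_neg_of_add_eq_zero_left h₂]
    abel
  have h₅ : ι ≫ fst ≫ inl ≫ ρ =
      -(ι ≫ snd ≫ inr ≫ d ≫ ψ ≫ inl ≫ ρ) - ι ≫ fst ≫ a' ≫ b' ≫ inl ≫ ρ := by
    simpa using h₄ =≫ (inl ≫ ρ)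
  refine (hQ'.biprod hP).of_retract (biprod.lift (ι ≫ fst ≫ a') (ι ≫ snd))
    (biprod.desc (-(b' ≫ inl ≫ ρ)) (inr ≫ ρ - inr ≫ d ≫ ψ ≫ inl ≫ ρ)) ?_
  rw [biprod.lift_desc, ← h₃, h₅]
  simp only [Preadditive.comp_neg, Preadditive.comp_sub, Category.assoc]
  abel

end IsExactCategory

namespace IsFrobeniusCategory

variable (hE : IsFrobeniusCategory E)
include hE

/-- The intermediate projective is injective, so the difference extends along any inflation. This
converts stable equalities into strict ones. -/
lemma exists_extend {X Y J : C} {f g : X ⟶ Y} (h : stableRel E f g) {i : X ⟶ J}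
    (hi : Inflation E i) : ∃ e : J ⟶ Y, f - g = i ≫ e := by
  obtain ⟨P, a, b, hP, e⟩ := h
  obtain ⟨c, hc⟩ := (hE.proj_iff_inj P).1 hP i hi a
  exact ⟨c ≫ b, by rw [e, reassoc_of% hc]⟩

/-- A projective kernel is injective, so `d` splits; the stable inverse is the section followed by
`fst`. -/
lemma stIso_of_isProj {L M T P Y : C} {ι : L ⟶ M} {d : M ⟶ Y} (h : Conf E ι d)
    (hL : IsProj E L) (hP : IsProj E P)
    {fst : M ⟶ T} {snd : M ⟶ P} {inl : T ⟶ M} {inr : P ⟶ M}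
    (total : fst ≫ inl + snd ≫ inr = 𝟙 M) (inl_fst : inl ≫ fst = 𝟙 T) : StIso E (inl ≫ d) := by
  have := h.epi hE.exact
  obtain ⟨ρ, hρ⟩ := (hE.proj_iff_inj L).1 hL ι h.inflation (𝟙 L)
  obtain ⟨σ, hσ⟩ := h.exists_desc hE.exact (𝟙 M - ρ ≫ ι)
    (by rw [Preadditive.comp_sub, reassoc_of% hρ]; simp)
  have hσd : σ ≫ d = 𝟙 Y := by
    rw [← cancel_epi d, reassoc_of% hσ, Preadditive.sub_comp, Category.assoc, h.w]
    simp
  refine ⟨σ ≫ fst, stableRel_of_factor hL (-(inl ≫ ρ)) (ι ≫ fst) ?_,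
    stableRel_of_factor hP (-(σ ≫ snd)) (inr ≫ d) ?_⟩
  · simp only [Category.assoc, reassoc_of% hσ, Preadditive.sub_comp, Preadditive.comp_sub,
      Category.id_comp, inl_fst, Preadditive.neg_comp]
    abel
  · have := σ ≫= total =≫ d
    simp only [Preadditive.add_comp, Preadditive.comp_add, Category.assoc, Category.id_comp,
      hσd] at this
    simp only [Category.assoc, Preadditive.neg_comp, ← this]
    abel

end IsFrobeniusCategory

end Stable

/-! ### Stable fullness, faithfulness and density: the inductive steps. -/

section Functors

variable {A : Type u} [Category.{v} A] [Preadditive A]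
  {B : Type u'} [Category.{v'} B] [Preadditive B]
  {E : ObjectProperty (ShortComplex A)} {E' : ObjectProperty (ShortComplex B)}
  {F : A ⥤ B} [F.Additive]

lemma IsExactFunctor.map_conf (hF : IsExactFunctor E E' F) {X Y Z : A} {i : X ⟶ Y} {p : Y ⟶ Z}
    (h : Conf E i p) : Conf E' (F.map i) (F.map p) :=
  ⟨by rw [← F.map_comp, h.w, F.map_zero], hF _ h.2⟩

/-- A stably full exact functor that reflects stable automorphisms is stably faithful. -/
lemma IsFrobeniusCategory.stableRel_zero_of_map (hE : IsFrobeniusCategory E)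
    (hE' : IsExactCategory E') (hF : IsExactFunctor E E' F)
    (full : ∀ {X Y : A} (g : F.obj X ⟶ F.obj Y), ∃ f : X ⟶ Y, stableRel E' (F.map f) g)
    (refl : ∀ {X : A} (e : X ⟶ X), stableRel E' (F.map e) (𝟙 _) → StIso E e)
    {X Y : A} {f : X ⟶ Y} (hf : stableRel E' (F.map f) 0) : stableRel E f 0 := by
  have := hE.exact.hasBinaryBiproducts
  obtain ⟨P, p, hP, hp⟩ := hE.enough_projectives Y
  obtain ⟨K, ι, h⟩ := (hE.exact.deflation_desc hp f).exists_conf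
  obtain ⟨Z, z, hz⟩ := hp.exists_conf
  obtain ⟨Q, a, b, hQ, e⟩ := hf
  obtain ⟨c, hc⟩ := hQ _ (hF.map_conf hz).deflation b
  rw [sub_zero] at e
  -- Since `F.map f = a ≫ c ≫ F.map p`, the map with components `𝟙` and `-(a ≫ c)` lands in the
  -- kernel `F.obj K` and is a section of `F.obj K ⟶ F.obj X`.
  obtain ⟨t, ht⟩ := (hF.map_conf h).exists_lift hE'
    (F.map biprod.inl - a ≫ c ≫ F.map biprod.inr) (by
      simp only [Preadditive.sub_comp, Category.assoc, ← F.map_comp, biprod.inl_desc,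
        biprod.inr_desc, hc, e, sub_self])
  have ht' : t ≫ F.map (ι ≫ biprod.fst) = 𝟙 _ := by
    rw [F.map_comp, reassoc_of% ht]
    simp [← F.map_comp]
  -- A stable preimage `s` of the section gives an endomorphism `s ≫ ι ≫ fst` with stable inverse
  -- `r`. So `f` is stably `r ≫ s ≫ ι ≫ fst ≫ f`, which factors through `P` because `ι` is killed by
  -- `(f, p)`.
  obtain ⟨s, hs⟩ := full t
  obtain ⟨r, -, hr⟩ := refl (s ≫ ι ≫ biprod.fst) (by
    rw [← ht', F.map_comp]
    exact hE'.stableRel_comp_right _ hs)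
  have hk : ι ≫ biprod.fst ≫ f = -(ι ≫ biprod.snd ≫ p) := by
    have := h.w
    rw [biprod.desc_eq, Preadditive.comp_add] at this
    exact eq_neg_of_add_eq_zero_left this
  refine hE.exact.stableRel_trans (hE.exact.stableRel_symm
    (by simpa using hE.exact.stableRel_comp_right f hr))
    (stableRel_of_factor hP (-(r ≫ s ≫ ι ≫ biprod.snd)) p ?_)
  simp [hk]

namespace IsPretriangleEquivalence

variable (hF : IsPretriangleEquivalence E E' F)
include hF

lemma exists_map (hE' : IsExactCategory E') {X Y : A} (g : F.obj X ⟶ F.obj Y) :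
    ∃ f : X ⟶ Y, stableRel E' (F.map f) g := by
  have := hF.isEquivalence
  obtain ⟨f, hf⟩ := (stableFunctor E E' F hF.map_proj).map_surjective
    (X := (Quotient.functor _).obj X) (Y := (Quotient.functor _).obj Y)
    ((Quotient.functor (stableRel E')).map g)
  obtain ⟨f, rfl⟩ := (Quotient.functor (stableRel E)).map_surjective f
  exact ⟨f, (hE'.functor_map_eq_iff _ _).1 hf⟩

lemma stableRel_of_map (hE : IsExactCategory E) {X Y : A} {f g : X ⟶ Y}
    (h : stableRel E' (F.map f) (F.map g)) : stableRel E f g := by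
  have := hF.isEquivalence
  rw [← hE.functor_map_eq_iff]
  exact (stableFunctor E E' F hF.map_proj).map_injective (CategoryTheory.Quotient.sound _ h)

lemma exists_obj (hE' : IsExactCategory E') (Y : B) :
    ∃ (X : A) (φ : F.obj X ⟶ Y), StIso E' φ := by
  have := hF.isEquivalence
  let e := (stableFunctor E E' F hF.map_proj).objObjPreimageIso
    ((Quotient.functor (stableRel E')).obj Y)
  let X := ((stableFunctor E E' F hF.map_proj).objPreimage
    ((Quotient.functor (stableRel E')).obj Y)).as
  obtain ⟨φ, hφ⟩ := (Quotient.functor (stableRel E')).map_surjective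
    (X := F.obj X) (Y := Y) e.hom
  refine ⟨X, φ, (hE'.stIso_iff φ).2 ?_⟩
  rw [hφ]
  exact e.isIso_hom

/-- The inductive step in the proof that the functor on inflation sequences is stably full. -/
lemma exists_map_step (hE : IsFrobeniusCategory E) (hE' : IsFrobeniusCategory E')
    {X X' I I' Z Z' Y : A} {i : X ⟶ I} {z : I ⟶ Z} (h : Conf E i z) {i' : X' ⟶ I'} {z' : I' ⟶ Z'}
    (h' : Conf E i' z') (hI : IsInj E I) {x : X ⟶ X'} {a : I ⟶ I'} {c : Z ⟶ Z'}
    (h₁ : i ≫ a = x ≫ i') (h₂ : z ≫ c = a ≫ z') (hx : Inflation E x) (hc : Inflation E c)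
    (f : X ⟶ Y) (e : F.obj I ⟶ F.obj Y) (g : F.obj X' ⟶ F.obj Y)
    (hg : F.map x ≫ g = F.map f + F.map i ≫ e) :
    ∃ (f' : X' ⟶ Y) (e' : F.obj I' ⟶ F.obj Y), x ≫ f' = f ∧ F.map a ≫ e' = e ∧
      g = F.map f' + F.map i' ≫ e' := by
  have hFI := hF.map_proj I ((hE.proj_iff_inj I).2 hI)
  -- A stable preimage of `g` restricts to `f` along `x` only stably; the error extends along `x`
  -- and is subtracted.
  obtain ⟨f₀, hf₀⟩ : ∃ f₀ : X' ⟶ Y, x ≫ f₀ = f := by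
    obtain ⟨k, hk⟩ := hF.exists_map hE'.exact g
    have : stableRel E (x ≫ k) f := by
      refine hF.stableRel_of_map hE.exact ?_
      rw [F.map_comp]
      refine hE'.exact.stableRel_trans (hE'.exact.stableRel_comp_left _ hk)
        (stableRel_of_factor hFI (F.map i) e ?_)
      rw [hg, add_sub_cancel_left]
    obtain ⟨u, hu⟩ := hE.exists_extend this hx
    exact ⟨k - u, by rw [Preadditive.comp_sub, ← hu]; abel⟩
  obtain ⟨W, w, hw⟩ := hx.exists_conf
  obtain ⟨P, j, b, q, sq, hb, hjq⟩ := hE.exact.exists_pushout hw i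
  have hd := hE.exact.inflation_corner h h' h₂ hc sq.flip (d := sq.desc i' a h₁.symm)
    (by simp) (by simp)
  have hjd : j ≫ sq.desc i' a h₁.symm = i' := by simp
  have hbd : b ≫ sq.desc i' a h₁.symm = a := by simp
  generalize sq.desc i' a h₁.symm = d at hd hjd hbd
  -- `F` preserves this pushout, so `g - F.map f₀` and `e` glue to a map `u` on `F.obj P`, still to
  -- be extended along `F.map d`.
  have SQ := hE'.exact.isPushout_of_conf (hF.exact.map_conf hw) (hF.exact.map_conf hb)
    (a := F.map i) (b := F.map j) (by rw [← F.map_comp, sq.w, F.map_comp])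
    (by rw [← F.map_comp, hjq])
  have w₀ : F.map x ≫ (g - F.map f₀) = F.map i ≫ e := by
    rw [Preadditive.comp_sub, hg, ← F.map_comp, hf₀, add_sub_cancel_left]
  have hu₁ := SQ.inl_desc _ _ w₀
  have hu₂ := SQ.inr_desc _ _ w₀
  generalize SQ.desc _ _ w₀ = u at hu₁ hu₂
  obtain ⟨k, hk⟩ := hF.exists_map hE'.exact u
  -- The stable preimage of `u` is changed to vanish on `I`, so that using it to correct `f₀`
  -- affects neither `x ≫ f'` nor `F.map a ≫ e'`.
  obtain ⟨r, hr⟩ := hI b hb.inflation (𝟙 I)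
  have hbk : b ≫ (k - r ≫ b ≫ k) = 0 := by
    rw [Preadditive.comp_sub, reassoc_of% hr, sub_self]
  have hku : stableRel E' u (F.map (k - r ≫ b ≫ k)) := by
    refine hE'.exact.stableRel_trans (hE'.exact.stableRel_symm hk)
      (stableRel_of_factor hFI (F.map r) (F.map (b ≫ k)) ?_)
    rw [← F.map_sub, sub_sub_cancel, F.map_comp]
  generalize k - r ≫ b ≫ k = l at hbk hku
  obtain ⟨e', he'⟩ := hE'.exists_extend hku (hF.exact.map_inflation hd)
  refine ⟨f₀ + j ≫ l, e', ?_, ?_, ?_⟩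
  · rw [Preadditive.comp_add, hf₀, reassoc_of% sq.w, hbk, comp_zero, add_zero]
  · rw [← hbd, F.map_comp, Category.assoc, ← he', Preadditive.comp_sub, hu₂, ← F.map_comp, hbk,
      F.map_zero, sub_zero]
  · rw [← hjd, F.map_comp, Category.assoc, ← he', Preadditive.comp_sub, hu₁, F.map_add,
      F.map_comp]
    abel

/-- The inductive step in the proof that the functor on inflation sequences is stably
essentially surjective. -/
lemma exists_obj_step (hE : IsFrobeniusCategory E) (hE' : IsFrobeniusCategory E')
    {X : A} {Y Y' : B} (φ : F.obj X ⟶ Y) (y : Y ⟶ Y') :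
    ∃ (X' : A) (x : X ⟶ X') (φ' : F.obj X' ⟶ Y'), Inflation E x ∧ StIso E' φ' ∧
      F.map x ≫ φ' = φ ≫ y := by
  have := hE.exact.hasBinaryBiproducts
  obtain ⟨W, ψ, hψ⟩ := hF.exists_obj hE'.exact Y'
  obtain ⟨ψ', -, hψ'⟩ := id hψ
  obtain ⟨u, hu⟩ := hF.exists_map hE'.exact (φ ≫ y ≫ ψ')
  obtain ⟨I, i, hI, hi⟩ := hE.enough_injectives X
  have hFI := hF.map_proj I ((hE.proj_iff_inj I).2 hI)
  have hu' : stableRel E' (φ ≫ y) (F.map u ≫ ψ) := by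
    refine hE'.exact.stableRel_symm (hE'.exact.stableRel_trans
      (hE'.exact.stableRel_comp_right ψ hu) ?_)
    simpa using hE'.exact.stableRel_comp_left (φ ≫ y) hψ'
  obtain ⟨e, he⟩ := hE'.exists_extend hu' (hF.exact.map_inflation hi)
  -- The summand `I` makes `u` an inflation and absorbs, through `e`, the failure of the square to
  -- commute strictly.
  refine ⟨W ⊞ I, biprod.lift u i, F.map biprod.fst ≫ ψ + F.map biprod.snd ≫ e,
    hE.exact.inflation_lift hi u, ?_, ?_⟩
  · refine hE'.exact.stIso_of_stableRel_comp (f := F.map biprod.fst) (g := ψ)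
      ⟨F.map biprod.inl, stableRel_of_factor hFI (-F.map biprod.snd) (F.map biprod.inr) ?_, ?_⟩
      hψ (stableRel_of_factor hFI (F.map biprod.snd) e (by abel))
    · rw [← F.map_comp, ← F.map_id, ← biprod.total, F.map_add, Preadditive.neg_comp, ← F.map_comp]
      abel
    · rw [← F.map_comp, biprod.inl_fst, F.map_id]
      exact hE'.exact.stableRel_refl _
  · rw [Preadditive.comp_add, ← F.map_comp_assoc, ← F.map_comp_assoc, biprod.lift_fst,
      biprod.lift_snd, ← he]
    abel

end IsPretriangleEquivalence

lemma IsPretriangleEquivalence.of_exists (hE' : IsExactCategory E')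
    (exact : IsExactFunctor E E' F) (map_proj : ∀ P : A, IsProj E P → IsProj E' (F.obj P))
    (full : ∀ {X Y : A} (g : F.obj X ⟶ F.obj Y), ∃ f : X ⟶ Y, stableRel E' (F.map f) g)
    (faithful : ∀ {X Y : A} {f : X ⟶ Y}, stableRel E' (F.map f) 0 → stableRel E f 0)
    (essSurj : ∀ Y : B, ∃ (X : A) (φ : F.obj X ⟶ Y), StIso E' φ) :
    IsPretriangleEquivalence E E' F where
  exact := exact
  map_proj := map_proj
  isEquivalence :=
    { full := ⟨fun {X Y} g => by
        obtain ⟨g, rfl⟩ := (Quotient.functor (stableRel E')).map_surjective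
          (X := F.obj X.as) (Y := F.obj Y.as) g
        obtain ⟨f, hf⟩ := full g
        exact ⟨(Quotient.functor (stableRel E)).map f, CategoryTheory.Quotient.sound _ hf⟩⟩
      faithful := ⟨fun {X Y} f g h => by
        obtain ⟨f, rfl⟩ := (Quotient.functor (stableRel E)).map_surjective
          (X := X.as) (Y := Y.as) f
        obtain ⟨g, rfl⟩ := (Quotient.functor (stableRel E)).map_surjective
          (X := X.as) (Y := Y.as) g
        have h' : stableRel E' (F.map f) (F.map g) := (hE'.functor_map_eq_iff _ _).1 h
        refine CategoryTheory.Quotient.sound _ ?_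
        have := (faithful (f := f - g)
          (by simpa [sub_eq_add_neg] using h'.add_left (-F.map g))).add_left g
        simpa using this⟩
      essSurj := ⟨fun Y => by
        obtain ⟨X, φ, hφ⟩ := essSurj Y.as
        have := (hE'.stIso_iff φ).1 hφ
        exact ⟨(Quotient.functor (stableRel E)).obj X,
          ⟨@asIso _ _ _ _ _ this⟩⟩⟩ }

end Functors

/-! ### The induced functor on stable categories of inflation sequences. -/

section InfStable

variable {A : Type u} [Category.{v} A] [Preadditive A]
  {B : Type u'} [Category.{v'} B] [Preadditive B]
  {E : ObjectProperty (ShortComplex A)} {E' : ObjectProperty (ShortComplex B)}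
  {F : A ⥤ B} [F.Additive] {m : ℕ}

lemma IsFrobeniusCategory.stableRel_app (hE : IsFrobeniusCategory E) {X Y : Inf E (m + 1)}
    {f g : X ⟶ Y} (h : stableRel (infConflations E (m + 1)) f g) (s : Fin (m + 1)) :
    stableRel E (f.hom.app s) (g.hom.app s) := by
  obtain ⟨P, a, b, hP, e⟩ := h
  exact ⟨P.obj.obj s, a.hom.app s, b.hom.app s, hE.isProj_inf_iff.1 hP s, by
    rw [← Inf.sub_app, e]; rfl⟩

/-- The pointwise stable inverses need not be compatible. Instead, the kernel of `(f, p)` is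
pointwise projective, hence projective. -/
lemma IsFrobeniusCategory.stIso_inf (hE : IsFrobeniusCategory E) {X Y : Inf E (m + 1)}
    {f : X ⟶ Y} (h : ∀ s, StIso E (f.hom.app s)) : StIso (infConflations E (m + 1)) f := by
  have hI := hE.inf (m := m)
  have := hI.exact.hasBinaryBiproducts
  obtain ⟨P, p, hP, hp⟩ := hE.exists_inf_deflation Y
  obtain ⟨L, ι, hc⟩ := (hI.exact.deflation_desc hp f).exists_conf
  have hinl : biprod.inl ≫ biprod.desc f p = f := by simp
  have hinr : biprod.inr ≫ biprod.desc f p = p := by simp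
  have hL : IsProj (infConflations E (m + 1)) L := hE.isProj_inf_iff.2 fun s =>
    hE.exact.isProj_of_stIso (conf_inf_iff.1 hc s) (hP s)
      (congr_arg (fun g => g.hom.app s) (biprod.total (X := X) (Y := P)))
      (by
        change Deflation E ((biprod.inr ≫ biprod.desc f p).hom.app s)
        rw [hinr]
        exact hp.app s)
      (by
        change StIso E ((biprod.inl ≫ biprod.desc f p).hom.app s)
        rw [hinl]
        exact h s)
  rw [← hinl]
  exact hI.stIso_of_isProj hc hL (hE.isProj_inf_iff.2 hP) biprod.total biprod.inl_fst

namespace IsPretriangleEquivalence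

variable (hF : IsPretriangleEquivalence E E' F)
include hF

lemma exists_inf_map (hE : IsFrobeniusCategory E) (hE' : IsFrobeniusCategory E')
    {X Y : Inf E (m + 1)}
    (g : (infFunctor (m + 1) F hF.exact).obj X ⟶ (infFunctor (m + 1) F hF.exact).obj Y) :
    ∃ f : X ⟶ Y, stableRel (infConflations E' (m + 1))
      ((infFunctor (m + 1) F hF.exact).map f) g := by
  obtain ⟨I, i, hI, hi⟩ := hE.exists_inf_inflation X
  obtain ⟨Z, z, h⟩ := hi.exists_conf
  have hc := conf_inf_iff.1 h
  obtain ⟨t, ht⟩ := exists_fin_seq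
    (σ := fun s => {t : (X.obj.obj s ⟶ Y.obj.obj s) ×
        (F.obj (I.obj.obj s) ⟶ F.obj (Y.obj.obj s)) //
      g.hom.app s = F.map t.1 + F.map (i.hom.app s) ≫ t.2})
    (fun k t t' => X.obj.map (succHom k) ≫ t'.1.1 = t.1.1 ≫ Y.obj.map (succHom k) ∧
      F.map (I.obj.map (succHom k)) ≫ t'.1.2 = t.1.2 ≫ F.map (Y.obj.map (succHom k)))
    (by
      obtain ⟨f, hf⟩ := hF.exists_map hE'.exact (g.hom.app 0)
      obtain ⟨e, he⟩ := hE'.exists_extend (hE'.exact.stableRel_symm hf)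
        (hF.exact.map_inflation (hi.app 0))
      exact ⟨(f, e), sub_eq_iff_eq_add'.1 he⟩)
    (by
      rintro k ⟨⟨f, e⟩, hfe⟩
      have hg : F.map (X.obj.map (succHom k)) ≫ g.hom.app k.succ =
          (F.map f + F.map (i.hom.app k.castSucc) ≫ e) ≫ F.map (Y.obj.map (succHom k)) :=
        (g.hom.naturality (succHom k)).trans
          (congr_arg (fun h => h ≫ F.map (Y.obj.map (succHom k))) hfe)
      obtain ⟨f', e', h₁, h₂, h₃⟩ := hF.exists_map_step hE hE' (hc k.castSucc) (hc k.succ)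
        (hI _) (i.hom.naturality (succHom k)).symm (z.hom.naturality (succHom k)).symm
        (isInflationSeq_iff.1 X.property k) (isInflationSeq_iff.1 Z.property k)
        (f ≫ Y.obj.map (succHom k)) (e ≫ F.map (Y.obj.map (succHom k))) (g.hom.app k.succ)
        (hg.trans (by simp; rfl))
      exact ⟨⟨(f', e'), h₃⟩, h₁, h₂⟩)
  let f : X ⟶ Y := ObjectProperty.homMk (natTransOfSucc (fun s => (t s).1.1) fun k => (ht k).1)
  let e : (infFunctor (m + 1) F hF.exact).obj I ⟶ (infFunctor (m + 1) F hF.exact).obj Y :=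
    ObjectProperty.homMk (natTransOfSucc (fun s => (t s).1.2) fun k => (ht k).2)
  refine ⟨f, hE'.inf.exact.stableRel_symm (stableRel_of_factor (hE'.isProj_inf_iff.2 fun s =>
    hF.map_proj _ ((hE.proj_iff_inj _).2 (hI s))) ((infFunctor (m + 1) F hF.exact).map i) e
    (Inf.hom_ext fun s => ?_))⟩
  rw [Inf.sub_app, (t s).2]
  exact add_sub_cancel_left _ _

lemma exists_inf_obj (hE : IsFrobeniusCategory E) (hE' : IsFrobeniusCategory E')
    (Y : Inf E' (m + 1)) :
    ∃ (X : Inf E (m + 1)) (φ : (infFunctor (m + 1) F hF.exact).obj X ⟶ Y),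
      StIso (infConflations E' (m + 1)) φ := by
  obtain ⟨t, ht⟩ := exists_fin_seq
    (σ := fun s => Σ X : A, {φ : F.obj X ⟶ Y.obj.obj s // StIso E' φ})
    (fun k t t' => ∃ x : t.1 ⟶ t'.1, Inflation E x ∧
      F.map x ≫ t'.2.1 = t.2.1 ≫ Y.obj.map (succHom k))
    (by
      obtain ⟨X, φ, hφ⟩ := hF.exists_obj hE'.exact (Y.obj.obj 0)
      exact ⟨X, φ, hφ⟩)
    (by
      rintro k ⟨X, φ, hφ⟩
      obtain ⟨X', x, φ', hx, hφ', e⟩ := hF.exists_obj_step hE hE' φ (Y.obj.map (succHom k))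
      exact ⟨⟨X', φ', hφ'⟩, x, hx, e⟩)
  choose x hx e using ht
  let X : Inf E (m + 1) :=
    ⟨ComposableArrows.mkOfObjOfMapSucc (fun s => (t s).1) x, isInflationSeq_iff.2 fun k => by
      rw [mkOfObjOfMapSucc_map_succHom]; exact hx k⟩
  let φ : (infFunctor (m + 1) F hF.exact).obj X ⟶ Y :=
    ObjectProperty.homMk (natTransOfSucc (fun s => (t s).2.1) fun k => by
      change F.map ((ComposableArrows.mkOfObjOfMapSucc (fun s => (t s).1) x).map (succHom k)) ≫ _
        = _
      rw [mkOfObjOfMapSucc_map_succHom]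
      exact e k)
  exact ⟨X, φ, hE'.stIso_inf fun s => (t s).2.2⟩

theorem inf (hE : IsFrobeniusCategory E) (hE' : IsFrobeniusCategory E') :
    IsPretriangleEquivalence (infConflations E (m + 1)) (infConflations E' (m + 1))
      (infFunctor (m + 1) F hF.exact) := by
  have exact : IsExactFunctor (infConflations E (m + 1)) (infConflations E' (m + 1))
      (infFunctor (m + 1) F hF.exact) := fun S hS s => hF.exact _ (hS s)
  refine .of_exists hE'.inf.exact exact
    (fun P hP => hE'.isProj_inf_iff.2 fun s => hF.map_proj _ (hE.isProj_inf_iff.1 hP s))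
    (hF.exists_inf_map hE hE') ?_ (hF.exists_inf_obj hE hE')
  refine hE.inf.stableRel_zero_of_map hE'.inf.exact exact (hF.exists_inf_map hE hE')
    fun e he => hE.stIso_inf fun s => ?_
  -- Faithfulness of `F` makes each component of `e` stably the identity, so `e` is a stable
  -- isomorphism, though not yet known to be stably the identity.
  have : stableRel E (e.hom.app s) (𝟙 _) := hF.stableRel_of_map hE.exact (by
    rw [F.map_id]
    exact hE'.stableRel_app he s)
  exact ⟨𝟙 _, by simpa using this, by simpa using this⟩

end IsPretriangleEquivalence

end InfStable

end FrobeniusInflation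

open FrobeniusInflation in
theorem proposition3 {A : Type u} [Category.{v} A] [Preadditive A]
    {B : Type u'} [Category.{v'} B] [Preadditive B]
    (E : ObjectProperty (ShortComplex A)) (E' : ObjectProperty (ShortComplex B))
    (hA : IsFrobeniusCategory E) (hB : IsFrobeniusCategory E')
    (F : A ⥤ B) [F.Additive] (hF : IsPretriangleEquivalence E E' F)
    (n : ℕ) (hn : 1 ≤ n) :
    IsFrobeniusCategory (infConflations E n) ∧
      IsFrobeniusCategory (infConflations E' n) ∧
      IsPretriangleEquivalence (infConflations E n) (infConflations E' n)
        (infFunctor n F hF.exact) := by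
  -- The recursions start at index `0`, so `Fin n` must be nonempty.
  obtain ⟨m, rfl⟩ := Nat.exists_eq_succ_of_ne_zero (Nat.one_le_iff_ne_zero.1 hn)
  exact ⟨hA.inf, hB.inf, hF.inf hA hB⟩
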